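/- Let $R$ be a commutative ring and let $I\lhd R$ be an ideal generated by a finite regular sequence $r_1,\dots,r_n$ (each $r_k$ is a non-zero divisor on $R/(r_1,\dots,r_{k-1})$, and $R/I\neq 0$). Write $\operatorname{Tor}_*=\operatorname{Tor}_*^R$. For $s\ge 1$ let $$\widetilde{\operatorname{Tor}}_*(R/I,R/I^s)=\operatorname{coker}\bigl(R/I\cong\operatorname{Tor}_*(R/I,R)\to\operatorname{Tor}_*(R/I,R/I^s)\bigr),$$ where the map is induced by the projection $R\to R/I^s$, and let $\pi:\operatorname{Tor}_*(R/I,R/I^s)\to\widetilde{\operatorname{Tor}}_*(R/I,R/I^s)$ be the projection. The map $R/I\to\operatorname{Tor}_*(R/I,R/I^s)$ is split by the augmentation $\operatorname{Tor}_*(R/I,R/I^s)\to R/I$ (with $R/I$ in degree $0$) induced by $R/I^s\to R/I$ and the multiplication of $R/I$; thus $\operatorname{Tor}_*(R/I,R/I^s)\cong R/I\oplus\widetilde{\operatorname{Tor}}_*(R/I,R/I^s)$, and $\widetilde{\operatorname{Tor}}_*(R/I,R/I^s)$ is identified with the kernel of the augmentation, which is an ideal for the internal product of $\operatorname{Tor}_*(R/I,R/I^s)$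 (induced by the $R$-algebra structures of $R/I$ and $R/I^s$). Let $s>1$, let $i:I^{s-1}/I^s\to R/I^s$ be the inclusion, and let $\partial$ be the connecting homomorphism of the short exact sequence $0\to I^{s-1}/I^s\to I^{s-2}/I^s\to I^{s-2}/I^{s-1}\to 0$. Then: 1. the sequence of graded $R/I$-modules $$\operatorname{Tor}_{*+1}(R/I,I^{s-2}/I^{s-1})\xrightarrow{\ \partial\ }\operatorname{Tor}_*(R/I,I^{s-1}/I^s)\xrightarrow{\ \pi i_*\ }\widetilde{\operatorname{Tor}}_*(R/I,R/I^s)\to 0$$ is exact in every degree $*\ge 0$; 2. $\widetilde{\operatorname{Tor}}_*(R/I,R/I^s)$ is free over $R/I$ (in every degree); 3. the product on $\widetilde{\operatorname{Tor}}_*(R/I,R/I^s)$ is trivial: $x\cdot y=0$ in $\operatorname{Tor}_{i+j}(R/I,R/I^s)$ for all $x\in\widetilde{\operatorname{Tor}}_i(R/I,R/I^s)$ and $y\in\widetilde{\operatorname{Tor}}_j(R/I,R/I^s)$. -/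

import Mathlib

open CategoryTheory MonoidalCategory TensorProduct

universe u

noncomputable section

namespace RegularQuotient

variable {R : Type u} [CommRing R]

/-! ### The modules `I^a/I^b` and the maps between them -/

/-- The `R`-module `I^a/I^b` (of interest when `a ≤ b`). -/
abbrev PowQuot (I : Ideal R) (a b : ℕ) : Type u :=
  ↥(I ^ a) ⧸ Submodule.comap (I ^ a).subtype (I ^ b)

/-- The map `I^a/I^b → I^a'/I^b'` induced by the inclusion `I^a ⊆ I^a'`. -/
def powQuotMap (I : Ideal R) {a b a' b' : ℕ} (ha : a' ≤ a) (hb : b' ≤ b) :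
    PowQuot I a b →ₗ[R] PowQuot I a' b' :=
  Submodule.mapQ _ _ (Submodule.inclusion (Ideal.pow_le_pow_right ha))
    (fun _ hx => Ideal.pow_le_pow_right hb hx)

/-- The inclusion `I^a/I^b → R/I^b`. -/
def powQuotIncl (I : Ideal R) (a b : ℕ) : PowQuot I a b →ₗ[R] R ⧸ I ^ b :=
  Submodule.mapQ _ _ (I ^ a).subtype (fun _ hx => hx)

lemma powQuot_exact (I : Ideal R) {a b c : ℕ} (hab : a ≤ b) (hbc : b ≤ c) :
    Function.Injective (powQuotMap I hab le_rfl : PowQuot I b c →ₗ[R] PowQuot I a c) ∧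
    Function.Exact (powQuotMap I hab le_rfl : PowQuot I b c →ₗ[R] PowQuot I a c)
      (powQuotMap I le_rfl hbc : PowQuot I a c →ₗ[R] PowQuot I a b) ∧
    Function.Surjective (powQuotMap I le_rfl hbc : PowQuot I a c →ₗ[R] PowQuot I a b) := by
  refine ⟨?_, ?_, ?_⟩
  · rw [injective_iff_map_eq_zero]
    intro x hx
    obtain ⟨x, rfl⟩ := Submodule.Quotient.mk_surjective _ x
    exact (Submodule.Quotient.mk_eq_zero _).2 ((Submodule.Quotient.mk_eq_zero _).1 hx :)
  · intro y
    obtain ⟨y, rfl⟩ := Submodule.Quotient.mk_surjective _ y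
    constructor
    · intro hy
      have hy' : (y : R) ∈ I ^ b :=
        (Submodule.Quotient.mk_eq_zero (Submodule.comap (I ^ a).subtype (I ^ b))).1 hy
      exact ⟨Submodule.Quotient.mk ⟨y.1, hy'⟩, rfl⟩
    · rintro ⟨x, hx⟩
      obtain ⟨x, rfl⟩ := Submodule.Quotient.mk_surjective _ x
      rw [← hx]
      exact (Submodule.Quotient.mk_eq_zero _).2 x.2
  · intro y
    obtain ⟨y, rfl⟩ := Submodule.Quotient.mk_surjective _ y
    exact ⟨Submodule.Quotient.mk y, rfl⟩

/-! ### The groups `Tor_n(R/I, M)` -/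

/-- The `R`-module `Tor_n(R/I, M)`, i.e. the `n`-th homology of `P ⊗ M` for a projective resolution `P`
of `R/I`. -/
abbrev tor (I : Ideal R) (n : ℕ) (M : Type u) [AddCommGroup M] [Module R M] : ModuleCat.{u} R :=
  ((Tor' (ModuleCat.{u} R) n).obj (ModuleCat.of R (R ⧸ I))).obj (ModuleCat.of R M)

/-- The map `Tor_n(R/I, M) → Tor_n(R/I, N)` induced by `f : M → N`. -/
abbrev torMap (I : Ideal R) (n : ℕ) {M N : Type u} [AddCommGroup M] [Module R M]
    [AddCommGroup N] [Module R N] (f : M →ₗ[R] N) : tor I n M →ₗ[R] tor I n N :=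
  (((Tor' (ModuleCat.{u} R) n).obj (ModuleCat.of R (R ⧸ I))).map (ModuleCat.ofHom f)).hom

/-- A projective resolution of `R/I` over `R`. -/
abbrev Resolution (I : Ideal R) := ProjectiveResolution (ModuleCat.of R (R ⧸ I))

/-- The augmentation `P_0 → R/I` of the resolution `P`. -/
abbrev Resolution.aug {I : Ideal R} (P : Resolution I) : P.complex.X 0 →ₗ[R] R ⧸ I :=
  (P.π.f 0).hom

/-- The complex `P ⊗ M`. -/
abbrev tensorComplex {I : Ideal R} (P : Resolution I) (M : Type u) [AddCommGroup M] [Module R M] :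
    ChainComplex (ModuleCat.{u} R) ℕ :=
  (((tensoringRight (ModuleCat.{u} R)).obj (ModuleCat.of R M)).mapHomologicalComplex
    (ComplexShape.down ℕ)).obj P.complex

/-- The chain map `P ⊗ M → P ⊗ N` induced by `f : M → N`. -/
abbrev tensorComplexMap {I : Ideal R} (P : Resolution I) {M N : Type u} [AddCommGroup M]
    [Module R M] [AddCommGroup N] [Module R N] (f : M →ₗ[R] N) :
    tensorComplex P M ⟶ tensorComplex P N :=
  (NatTrans.mapHomologicalComplex ((tensoringRight (ModuleCat.{u} R)).map (ModuleCat.ofHom f))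
    (ComplexShape.down ℕ)).app P.complex

/-- The identification of `Tor_n(R/I, M)` with the homology of `P ⊗ M`. -/
abbrev torIso {I : Ideal R} (P : Resolution I) (n : ℕ) (M : Type u) [AddCommGroup M] [Module R M] :
    tor I n M ≅ (tensorComplex P M).homology n :=
  P.isoLeftDerivedObj ((tensoringRight (ModuleCat.{u} R)).obj (ModuleCat.of R M)) n

lemma torMap_eq {I : Ideal R} (P : Resolution I) (n : ℕ) {M N : Type u} [AddCommGroup M]
    [Module R M] [AddCommGroup N] [Module R N] (f : M →ₗ[R] N) :
    ModuleCat.ofHom (torMap I n f) = (torIso P n M).hom ≫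
      HomologicalComplex.homologyMap (tensorComplexMap P f) n ≫ (torIso P n N).inv :=
  P.leftDerived_app_eq ((tensoringRight (ModuleCat.{u} R)).map (ModuleCat.ofHom f)) n

lemma smul_tor_eq_zero (I : Ideal R) (n : ℕ) (M : Type u) [AddCommGroup M] [Module R M]
    (r : R) (hr : r ∈ I) (x : tor I n M) : r • x = 0 := by
  let F := (tensoringRight (ModuleCat.{u} R)).obj (ModuleCat.of R M)
  let P : Resolution I := projectiveResolution _
  have h0 : ∀ y : R ⧸ I, r • y = 0 := by
    intro y
    obtain ⟨y, rfl⟩ := Ideal.Quotient.mk_surjective y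
    exact (Submodule.Quotient.mk_eq_zero _).2 (I.mul_mem_right y hr)
  have hπ : (r • 𝟙 P.complex) ≫ P.π = 0 := by
    rw [Linear.smul_comp, Category.id_comp]
    apply HomologicalComplex.to_single_hom_ext
    exact ModuleCat.hom_ext (LinearMap.ext fun x => h0 ((P.π.f 0).hom x))
  have h1 := F.leftDerived_map_eq n 0 (P := P) (Q := P) (r • 𝟙 P.complex) (by
    rw [hπ, Functor.map_zero, Limits.comp_zero])
  have h2 := F.leftDerived_map_eq n 0 (P := P) (Q := P) 0 (by
    rw [Limits.zero_comp, Functor.map_zero, Limits.comp_zero])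
  have hl : (F.mapHomologicalComplex _ ⋙ HomologicalComplex.homologyFunctor _ _ n).map
      (r • 𝟙 P.complex) = r • 𝟙 _ := by
    have h3 : (F.mapHomologicalComplex (ComplexShape.down ℕ)).map (r • 𝟙 P.complex) = r • 𝟙 _ := by
      rw [Functor.map_smul, CategoryTheory.Functor.map_id]
    rw [Functor.comp_map, h3]
    change HomologicalComplex.homologyMap _ n = _
    have h4 : (HomologicalComplex.shortComplexFunctor (ModuleCat.{u} R) (ComplexShape.down ℕ) n).map
        (r • 𝟙 ((F.mapHomologicalComplex (ComplexShape.down ℕ)).obj P.complex)) = r • 𝟙 _ := rfl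
    rw [HomologicalComplex.homologyMap, h4, ShortComplex.homologyMap_smul,
      ShortComplex.homologyMap_id]
    rfl
  rw [h2, hl, Functor.map_zero, Limits.zero_comp, Limits.comp_zero, Linear.smul_comp,
    Linear.comp_smul] at h1
  have h5 : (0 : tor I n M ⟶ tor I n M) = r • 𝟙 _ :=
    h1.trans (congrArg (r • ·) ((congrArg ((P.isoLeftDerivedObj F n).hom ≫ ·)
      (Category.id_comp _)).trans (Iso.hom_inv_id _)))
  exact (congrArg (fun f => f.hom x) h5).symm

/-- `Tor_n(R/I, M)` is an `R/I`-module, as it is annihilated by `I`. In particular, `R`-linear maps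
between such modules are `R/I`-linear. -/
instance torModule (I : Ideal R) (n : ℕ) (M : Type u) [AddCommGroup M] [Module R M] :
    Module (R ⧸ I) (tor I n M) :=
  Module.IsTorsionBySet.module (fun x r => smul_tor_eq_zero I n M r.1 r.2 x)

instance torTower (I : Ideal R) (n : ℕ) (M : Type u) [AddCommGroup M] [Module R M] :
    IsScalarTower R (R ⧸ I) (tor I n M) :=
  Module.IsTorsionBySet.isScalarTower _

/-! ### The connecting homomorphism -/

/-- The short exact sequence `0 → I^b/I^c → I^a/I^c → I^a/I^b → 0` tensored with a projective
resolution `P` of `R/I`. -/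
def tensorShortComplex {I : Ideal R} (P : Resolution I) {a b c : ℕ} (hab : a ≤ b) (hbc : b ≤ c) :
    ShortComplex (ChainComplex (ModuleCat.{u} R) ℕ) where
  X₁ := tensorComplex P (PowQuot I b c)
  X₂ := tensorComplex P (PowQuot I a c)
  X₃ := tensorComplex P (PowQuot I a b)
  f := tensorComplexMap P (powQuotMap I hab le_rfl)
  g := tensorComplexMap P (powQuotMap I le_rfl hbc)
  zero := by
    ext i : 1
    refine ModuleCat.hom_ext ?_
    refine TensorProduct.ext' fun p x => ?_
    have := (powQuot_exact I hab hbc).2.1.apply_apply_eq_zero x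
    exact (congrArg (fun y => p ⊗ₜ[R] y) this).trans (TensorProduct.tmul_zero _ _)

lemma tensorShortComplex_shortExact {I : Ideal R} (P : Resolution I) {a b c : ℕ} (hab : a ≤ b)
    (hbc : b ≤ c) : (tensorShortComplex P hab hbc).ShortExact := by
  refine HomologicalComplex.shortExact_of_degreewise_shortExact _ fun i => ?_
  have : Module.Projective R (P.complex.X i) :=
    (IsProjective.iff_projective _).2 (P.projective i)
  obtain ⟨h1, h2, h3⟩ := powQuot_exact I hab hbc
  refine ModuleCat.shortComplex_shortExact _ ?_ ?_ ?_
  · exact lTensor_exact (P.complex.X i) h2 h3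
  · exact Module.Flat.lTensor_preserves_injective_linearMap _ h1
  · exact LinearMap.lTensor_surjective (P.complex.X i) h3

/-- The connecting homomorphism `Tor_{n+1}(R/I, I^a/I^b) → Tor_n(R/I, I^b/I^c)` of the short exact
sequence `0 → I^b/I^c → I^a/I^c → I^a/I^b → 0`. -/
def connecting {I : Ideal R} (P : Resolution I) {a b c : ℕ} (hab : a ≤ b) (hbc : b ≤ c) (n : ℕ) :
    tor I (n + 1) (PowQuot I a b) →ₗ[R] tor I n (PowQuot I b c) :=
  ((torIso P (n + 1) (PowQuot I a b)).hom ≫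
    (tensorShortComplex_shortExact P hab hbc).δ (n + 1) n rfl ≫
      (torIso P n (PowQuot I b c)).inv).hom

/-! ### The reduced `Tor` -/

/-- The map `Tor_n(R/I, R) → Tor_n(R/I, R/J)` induced by the projection `R → R/J`. -/
abbrev torUnit (I J : Ideal R) (n : ℕ) : tor I n R →ₗ[R] tor I n (R ⧸ J) :=
  torMap I n J.mkQ

/-- The reduced `Tor_n(R/I, R/J)`: the cokernel of `Tor_n(R/I, R) → Tor_n(R/I, R/J)`. -/
abbrev reducedTor (I J : Ideal R) (n : ℕ) : Type u :=
  tor I n (R ⧸ J) ⧸ LinearMap.range (torUnit I J n)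

/-- The projection `Tor_n(R/I, R/J) → reducedTor_n(R/I, R/J)`. -/
abbrev reducedProj (I J : Ideal R) (n : ℕ) : tor I n (R ⧸ J) →ₗ[R] reducedTor I J n :=
  (LinearMap.range (torUnit I J n)).mkQ

instance reducedModule (I J : Ideal R) (n : ℕ) : Module (R ⧸ I) (reducedTor I J n) :=
  Module.IsTorsionBySet.module (R := R) (I := I) (fun x r => by
    obtain ⟨x, rfl⟩ := Submodule.mkQ_surjective _ x
    rw [← map_smul, smul_tor_eq_zero I n _ r.1 r.2 x, map_zero])

instance reducedTower (I J : Ideal R) (n : ℕ) : IsScalarTower R (R ⧸ I) (reducedTor I J n) :=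
  Module.IsTorsionBySet.isScalarTower _

/-- For `J ≤ I`, the chain map `P ⊗ R/J → R/I` (with `R/I` in degree `0`) sending `p ⊗ y` to
`π(p) y`, where `π : P → R/I` is the augmentation of the resolution. -/
def augComplexMap {I : Ideal R} (P : Resolution I) {J : Ideal R} (hJ : J ≤ I) :
    tensorComplex P (R ⧸ J) ⟶ (ChainComplex.single₀ (ModuleCat.{u} R)).obj (ModuleCat.of R (R ⧸ I)) :=
  HomologicalComplex.mkHomToSingle
    (ModuleCat.ofHom (TensorProduct.lift
      ((LinearMap.mul R (R ⧸ I)).compl₁₂ P.aug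
        (Submodule.factor hJ)) : (P.complex.X 0 ⊗[R] (R ⧸ J) : Type u) →ₗ[R] R ⧸ I))
    (fun i hi => by
      obtain rfl : i = 1 := by simpa using hi.symm
      refine ModuleCat.hom_ext ?_
      refine TensorProduct.ext' fun p x => ?_
      have h : (P.π.f 0).hom ((P.complex.d 1 0).hom p) = 0 :=
        congrArg (fun f => f.hom p) P.complex_d_comp_π_f_zero
      exact (congrArg (fun y : R ⧸ I => y * (Submodule.factor hJ) x) h).trans (zero_mul _))

/-- For `J ≤ I`, the augmentation `Tor_*(R/I, R/J) → R/I`, with `R/I` in degree `0`: the part of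
degree `n`. -/
def augmentation {I : Ideal R} (P : Resolution I) {J : Ideal R} (hJ : J ≤ I) (n : ℕ) :
    tor I n (R ⧸ J) →ₗ[R]
      ((ChainComplex.single₀ (ModuleCat.{u} R)).obj (ModuleCat.of R (R ⧸ I))).homology n :=
  ((torIso P n (R ⧸ J)).hom ≫ HomologicalComplex.homologyMap (augComplexMap P hJ) n).hom

lemma augmentation_torUnit_bijective {I : Ideal R} (P : Resolution I) {J : Ideal R} (hJ : J ≤ I)
    (n : ℕ) : Function.Bijective (augmentation P hJ n ∘ₗ torUnit I J n) := by
  let e : tensorComplex P R ≅ P.complex :=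
    HomologicalComplex.Hom.isoOfComponents (fun i => ρ_ (P.complex.X i)) (fun i j _ => by
      exact (MonoidalCategory.rightUnitor_naturality (P.complex.d i j)).symm)
  have h1 : tensorComplexMap P J.mkQ ≫ augComplexMap P hJ = e.hom ≫ P.π := by
    apply HomologicalComplex.to_single_hom_ext
    refine ModuleCat.hom_ext ?_
    refine TensorProduct.ext' fun p x => ?_
    have h : P.aug p * Ideal.Quotient.mk I x = x • P.aug p := by
      rw [mul_comm, Algebra.smul_def]; rfl
    exact h.trans (map_smul P.aug x p).symm
  have h2 : ModuleCat.ofHom (augmentation P hJ n ∘ₗ torUnit I J n) =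
      (torIso P n R).hom ≫ HomologicalComplex.homologyMap (e.hom ≫ P.π) n := by
    rw [ModuleCat.ofHom_comp, torMap_eq P, ← h1, HomologicalComplex.homologyMap_comp]
    simp [augmentation]
  have h3 : IsIso (ModuleCat.ofHom (augmentation P hJ n ∘ₗ torUnit I J n)) := by
    rw [h2, HomologicalComplex.homologyMap_comp]
    infer_instance
  exact (ConcreteCategory.isIso_iff_bijective _).1 h3

/-- The image of `R/I = Tor_*(R/I, R)` in `Tor_*(R/I, R/J)` is complemented by the kernel of the
augmentation. -/
lemma isCompl_ker_augmentation {I : Ideal R} (P : Resolution I) {J : Ideal R} (hJ : J ≤ I) (n : ℕ) :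
    IsCompl (LinearMap.range (torUnit I J n)) (LinearMap.ker (augmentation P hJ n)) := by
  obtain ⟨h1, h2⟩ := augmentation_torUnit_bijective P hJ n
  constructor
  · rw [Submodule.disjoint_def]
    rintro _ ⟨x, rfl⟩ hx
    rw [LinearMap.mem_ker] at hx
    have : x = 0 := h1 (by rw [LinearMap.comp_apply, hx, map_zero])
    rw [this, map_zero]
  · rw [codisjoint_iff, eq_top_iff]
    intro y _
    obtain ⟨x, hx⟩ := h2 (augmentation P hJ n y)
    rw [Submodule.mem_sup]
    refine ⟨torUnit I J n x, ⟨x, rfl⟩, y - torUnit I J n x, ?_, by abel⟩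
    rw [LinearMap.mem_ker, map_sub, ← hx, LinearMap.comp_apply, sub_self]

/-- The splitting `Tor_*(R/I, R/J) = R/I ⊕ reducedTor_*(R/I, R/J)`: the reduced `Tor` is identified
with the kernel of the augmentation, an ideal of `Tor_*(R/I, R/J)`. This is how the reduced `Tor`
inherits a product. -/
def reducedEquiv {I : Ideal R} (P : Resolution I) {J : Ideal R} (hJ : J ≤ I) (n : ℕ) :
    reducedTor I J n ≃ₗ[R] LinearMap.ker (augmentation P hJ n) :=
  Submodule.quotientEquivOfIsCompl _ _ (isCompl_ker_augmentation P hJ n)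

/-! ### The internal product -/

/-- A chain map `P ⊗ P → P` over the multiplication `R/I ⊗ R/I → R/I`. One exists (shown below), since
`P ⊗ P` is projective and `P` is acyclic in positive degrees; by the same token it is unique up to
homotopy. -/
structure ProductLift {I : Ideal R} (P : Resolution I) where
  hom : HomologicalComplex.tensorObj P.complex P.complex ⟶ P.complex
  aug_hom : ∀ p q : P.complex.X 0,
    P.aug ((hom.f 0).hom
      ((HomologicalComplex.ιTensorObj P.complex P.complex 0 0 0 rfl).hom (p ⊗ₜ[R] q))) =
    P.aug p * P.aug q

lemma exists_lift_of_projective {I : Ideal R} (P : Resolution I)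
    (T : ChainComplex (ModuleCat.{u} R) ℕ) (hT : ∀ n, Projective (T.X n))
    (f : T.X 0 ⟶ ModuleCat.of R (R ⧸ I)) (hf : T.d 1 0 ≫ f = 0) :
    ∃ g : T ⟶ P.complex, g.f 0 ≫ P.π.f 0 = f := by
  let π₀ : P.complex.X 0 ⟶ ModuleCat.of R (R ⧸ I) := P.π.f 0
  have : Epi π₀ := (inferInstance : Epi (P.π.f 0))
  let g0 : T.X 0 ⟶ P.complex.X 0 := Projective.factorThru f π₀
  have h0 : g0 ≫ π₀ = f := Projective.factorThru_comp _ _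
  let g1 : T.X 1 ⟶ P.complex.X 1 := P.exact₀.liftFromProjective (T.d 1 0 ≫ g0) (by
    exact (Category.assoc _ _ _).trans ((congrArg (T.d 1 0 ≫ ·) h0).trans hf))
  have h1 : g1 ≫ P.complex.d 1 0 = T.d 1 0 ≫ g0 := P.exact₀.liftFromProjective_comp _ _
  refine ⟨ChainComplex.mkHom _ _ g0 g1 h1 fun n ⟨g, g', w⟩ =>
    ⟨(P.exact_succ n).liftFromProjective (T.d (n + 2) (n + 1) ≫ g') (by simp [w]),
      (P.exact_succ n).liftFromProjective_comp _ _⟩, ?_⟩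
  simpa using h0

/-- The multiplication `P_i ⊗ P_j → R/I` for `i = j = 0`, and zero otherwise. -/
def augMul {I : Ideal R} (P : Resolution I) :
    ∀ i j : ℕ, P.complex.X i ⊗ P.complex.X j ⟶ ModuleCat.of R (R ⧸ I)
  | 0, 0 => ModuleCat.ofHom (TensorProduct.lift
      ((LinearMap.mul R (R ⧸ I)).compl₁₂ P.aug P.aug))
  | 0, _ + 1 => 0
  | _ + 1, _ => 0

lemma d_augMul_left {I : Ideal R} (P : Resolution I) (i j : ℕ) :
    (P.complex.d (i + 1) i ▷ P.complex.X j) ≫ augMul P i j = 0 := by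
  match i, j with
  | 0, 0 =>
    refine ModuleCat.hom_ext ?_
    refine TensorProduct.ext' fun p x => ?_
    have h : P.aug ((P.complex.d 1 0).hom p) = 0 :=
      congrArg (fun f => f.hom p) P.complex_d_comp_π_f_zero
    exact (congrArg (fun y : R ⧸ I => y * P.aug x) h).trans (zero_mul _)
  | 0, j + 1 => exact Limits.comp_zero
  | i + 1, j => exact Limits.comp_zero

lemma d_augMul_right {I : Ideal R} (P : Resolution I) (i j : ℕ) :
    (P.complex.X i ◁ P.complex.d (j + 1) j) ≫ augMul P i j = 0 := by
  match i, j with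
  | 0, 0 =>
    refine ModuleCat.hom_ext ?_
    refine TensorProduct.ext' fun x p => ?_
    have h : P.aug ((P.complex.d 1 0).hom p) = 0 :=
      congrArg (fun f => f.hom p) P.complex_d_comp_π_f_zero
    exact (congrArg (fun y : R ⧸ I => P.aug x * y) h).trans (mul_zero _)
  | 0, j + 1 => exact Limits.comp_zero
  | i + 1, j => exact Limits.comp_zero

instance {I : Ideal R} (P : Resolution I) (n : ℕ) :
    Projective ((HomologicalComplex.tensorObj P.complex P.complex).X n) := by
  have (i j : ℕ) : Projective (P.complex.X i ⊗ P.complex.X j) := by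
    have h1 : Module.Projective R (P.complex.X i) :=
      (IsProjective.iff_projective _).2 (P.projective i)
    have h2 : Module.Projective R (P.complex.X j) :=
      (IsProjective.iff_projective _).2 (P.projective j)
    exact (IsProjective.iff_projective _).1
      (inferInstance : Module.Projective R (P.complex.X i ⊗[R] P.complex.X j))
  constructor
  intro E X f e he
  refine ⟨HomologicalComplex.mapBifunctorDesc fun i j h =>
    @Projective.factorThru _ _ (P.complex.X i ⊗ P.complex.X j) _ _ (this i j)
      (HomologicalComplex.ιTensorObj P.complex P.complex i j n h ≫ f) e he, ?_⟩
  apply HomologicalComplex.mapBifunctor.hom_ext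
  intro i j h
  rw [HomologicalComplex.ι_mapBifunctorDesc_assoc]
  exact @Projective.factorThru_comp _ _ (P.complex.X i ⊗ P.complex.X j) _ _ (this i j)
    (HomologicalComplex.ιTensorObj P.complex P.complex i j n h ≫ f) e he

instance {I : Ideal R} (P : Resolution I) : Nonempty (ProductLift P) := by
  let f : (HomologicalComplex.tensorObj P.complex P.complex).X 0 ⟶ ModuleCat.of R (R ⧸ I) :=
    HomologicalComplex.mapBifunctorDesc fun i j _ => augMul P i j
  have hf : (HomologicalComplex.tensorObj P.complex P.complex).d 1 0 ≫ f = 0 := by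
    apply HomologicalComplex.mapBifunctor.hom_ext
    intro i j h
    rw [HomologicalComplex.mapBifunctor.d_eq, Preadditive.add_comp, Preadditive.comp_add,
      HomologicalComplex.mapBifunctor.ι_D₁_assoc, HomologicalComplex.mapBifunctor.ι_D₂_assoc]
    have h' : i + j = 1 := h
    obtain ⟨rfl, rfl⟩ | ⟨rfl, rfl⟩ : (i = 1 ∧ j = 0) ∨ (i = 0 ∧ j = 1) := by omega
    · rw [HomologicalComplex.mapBifunctor.d₁_eq _ _ _ _ (i₁' := 0) rfl _ 0 rfl,
        HomologicalComplex.mapBifunctor.d₂_eq_zero _ _ _ _ _ _ _ (by simp),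
        Linear.units_smul_comp, Category.assoc, HomologicalComplex.ι_mapBifunctorDesc,
        Limits.zero_comp, add_zero, Limits.comp_zero]
      exact (congrArg _ (d_augMul_left P 0 0)).trans (smul_zero _)
    · rw [HomologicalComplex.mapBifunctor.d₂_eq _ _ _ _ _ (i₂' := 0) rfl 0 rfl,
        HomologicalComplex.mapBifunctor.d₁_eq_zero _ _ _ _ _ _ _ (by simp),
        Linear.units_smul_comp, Category.assoc, HomologicalComplex.ι_mapBifunctorDesc,
        Limits.zero_comp, zero_add, Limits.comp_zero]
      exact (congrArg _ (d_augMul_right P 0 0)).trans (smul_zero _)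
  obtain ⟨g, hg⟩ := exists_lift_of_projective P _ inferInstance f hf
  refine ⟨⟨g, fun p q => ?_⟩⟩
  have h : HomologicalComplex.ιTensorObj P.complex P.complex 0 0 0 rfl ≫ g.f 0 ≫ P.π.f 0 =
      augMul P 0 0 := by
    rw [hg]; exact HomologicalComplex.ι_mapBifunctorDesc _ _ _ _
  exact congrArg (fun f => f.hom (p ⊗ₜ[R] q)) h

/-- The bilinear map `P_i × P_j → P_n` for `n = i + j`, given by a chain map `P ⊗ P → P`. -/
def ProductLift.pairing {I : Ideal R} {P : Resolution I} (μ : ProductLift P) (i j n : ℕ)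
    (h : i + j = n) : P.complex.X i →ₗ[R] P.complex.X j →ₗ[R] P.complex.X n :=
  TensorProduct.curry
    ((HomologicalComplex.ιTensorObj P.complex P.complex i j n h ≫ μ.hom.f n).hom)

/-- For an `R`-algebra `A`, the bilinear map `(P_i ⊗ A) × (P_j ⊗ A) → P_n ⊗ A` for `n = i + j`,
given by `(p ⊗ a, q ⊗ b) ↦ (p q) ⊗ (a b)`. -/
def ProductLift.mulChain {I : Ideal R} {P : Resolution I} (μ : ProductLift P) (A : Type u)
    [CommRing A] [Algebra R A] (i j n : ℕ) (h : i + j = n) :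
    (tensorComplex P A).X i →ₗ[R] (tensorComplex P A).X j →ₗ[R] (tensorComplex P A).X n :=
  TensorProduct.map₂ (μ.pairing i j n h) (LinearMap.mul R A)

section
variable {I : Ideal R} {P : Resolution I} (μ : ProductLift P) (A : Type u) [CommRing A]
  [Algebra R A]

/-- The bilinear map `(P_i ⊗ A) × (P_j ⊗ A) → P_n ⊗ A` given by `φ : P_i ⊗ P_j → (P ⊗ P)_n`. -/
def mulAux {i j n : ℕ} (φ : P.complex.X i ⊗ P.complex.X j ⟶
      (HomologicalComplex.tensorObj P.complex P.complex).X n) :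
    (tensorComplex P A).X i →ₗ[R] (tensorComplex P A).X j →ₗ[R] (tensorComplex P A).X n :=
  TensorProduct.map₂ (TensorProduct.curry (φ ≫ μ.hom.f n).hom) (LinearMap.mul R A)

lemma mulAux_tmul {i j n : ℕ} (φ : P.complex.X i ⊗ P.complex.X j ⟶
      (HomologicalComplex.tensorObj P.complex P.complex).X n)
      (p : P.complex.X i) (a : A) (q : P.complex.X j) (b : A) :
    mulAux μ A φ (p ⊗ₜ[R] a) (q ⊗ₜ[R] b) =
      (((μ.hom.f n).hom (φ.hom (p ⊗ₜ[R] q))) ⊗ₜ[R] (a * b) : P.complex.X n ⊗[R] A) := rfl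

lemma mulAux_ext {i j n : ℕ} {B C : (tensorComplex P A).X i →ₗ[R] (tensorComplex P A).X j →ₗ[R]
      (tensorComplex P A).X n}
    (h : ∀ (p : P.complex.X i) (a : A) (q : P.complex.X j) (b : A),
      B (p ⊗ₜ[R] a) (q ⊗ₜ[R] b) = C (p ⊗ₜ[R] a) (q ⊗ₜ[R] b)) : B = C := by
  refine TensorProduct.ext' fun p a => ?_
  refine TensorProduct.ext' fun q b => h p a q b

lemma mulAux_d {i j n n' : ℕ} (h : i + j = n) (x : (tensorComplex P A).X i)
    (y : (tensorComplex P A).X j) :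
    (tensorComplex P A).d n n' (μ.mulChain A i j n h x y) =
      mulAux μ A (HomologicalComplex.mapBifunctor.d₁ P.complex P.complex
        (curriedTensor (ModuleCat.{u} R)) (ComplexShape.down ℕ) i j n') x y +
      mulAux μ A (HomologicalComplex.mapBifunctor.d₂ P.complex P.complex
        (curriedTensor (ModuleCat.{u} R)) (ComplexShape.down ℕ) i j n') x y := by
  suffices H : (μ.mulChain A i j n h).compr₂ ((tensorComplex P A).d n n').hom =
      mulAux μ A (HomologicalComplex.mapBifunctor.d₁ P.complex P.complex
        (curriedTensor (ModuleCat.{u} R)) (ComplexShape.down ℕ) i j n') +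
      mulAux μ A (HomologicalComplex.mapBifunctor.d₂ P.complex P.complex
        (curriedTensor (ModuleCat.{u} R)) (ComplexShape.down ℕ) i j n') from
    congrArg (fun B => B x y) H
  refine mulAux_ext A fun p a q b => ?_
  have h1 : HomologicalComplex.ιTensorObj P.complex P.complex i j n h ≫ μ.hom.f n ≫
      P.complex.d n n' = HomologicalComplex.mapBifunctor.d₁ P.complex P.complex
        (curriedTensor (ModuleCat.{u} R)) (ComplexShape.down ℕ) i j n' ≫ μ.hom.f n' +
        HomologicalComplex.mapBifunctor.d₂ P.complex P.complex
        (curriedTensor (ModuleCat.{u} R)) (ComplexShape.down ℕ) i j n' ≫ μ.hom.f n' := by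
    rw [μ.hom.comm, HomologicalComplex.mapBifunctor.d_eq, Preadditive.add_comp,
      Preadditive.comp_add, HomologicalComplex.mapBifunctor.ι_D₁_assoc,
      HomologicalComplex.mapBifunctor.ι_D₂_assoc]
  have h2 := congrArg (fun f => f.hom (p ⊗ₜ[R] q)) h1
  exact (congrArg (fun z : P.complex.X n' => z ⊗ₜ[R] (a * b)) h2).trans
    (TensorProduct.add_tmul _ _ _)

lemma mulAux_units_smul {i j n : ℕ} (ε : ℤˣ) (φ : P.complex.X i ⊗ P.complex.X j ⟶
      (HomologicalComplex.tensorObj P.complex P.complex).X n)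
      (x : (tensorComplex P A).X i) (y : (tensorComplex P A).X j) :
    mulAux μ A (ε • φ) x y = ε • mulAux μ A φ x y := by
  obtain rfl | rfl := Int.units_eq_one_or ε
  · rw [one_smul, one_smul]
  · have h : mulAux μ A (-φ) = - mulAux μ A φ := by
      refine mulAux_ext A fun p a q b => ?_
      have h1 : (μ.hom.f n).hom ((-φ).hom (p ⊗ₜ[R] q)) =
          - (μ.hom.f n).hom (φ.hom (p ⊗ₜ[R] q)) := map_neg (μ.hom.f n).hom _
      exact (congrArg (fun z : P.complex.X n => z ⊗ₜ[R] (a * b)) h1).trans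
        (TensorProduct.neg_tmul _ _)
    rw [Units.neg_smul, one_smul, Units.neg_smul, one_smul, h]
    rfl

lemma mulAux_d₁ {i i' j n' : ℕ} (hi : i' + 1 = i) (x : (tensorComplex P A).X i)
    (y : (tensorComplex P A).X j) :
    ∃ ε : ℤˣ, mulAux μ A (HomologicalComplex.mapBifunctor.d₁ P.complex P.complex
        (curriedTensor (ModuleCat.{u} R)) (ComplexShape.down ℕ) i j n') x y =
      ε • mulAux μ A (HomologicalComplex.ιMapBifunctorOrZero P.complex P.complex
        (curriedTensor (ModuleCat.{u} R)) (ComplexShape.down ℕ) i' j n')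
        ((tensorComplex P A).d i i' x) y := by
  refine ⟨ComplexShape.ε₁ (ComplexShape.down ℕ) (ComplexShape.down ℕ) (ComplexShape.down ℕ) (i, j), ?_⟩
  rw [HomologicalComplex.mapBifunctor.d₁_eq' P.complex P.complex
    (curriedTensor (ModuleCat.{u} R)) (ComplexShape.down ℕ) (i₁ := i) (i₁' := i') hi j n']
  refine (mulAux_units_smul μ A _ _ x y).trans (congrArg _ ?_)
  have H : mulAux μ A (((curriedTensor (ModuleCat.{u} R)).map (P.complex.d i i')).app
      (P.complex.X j) ≫ HomologicalComplex.ιMapBifunctorOrZero P.complex P.complex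
        (curriedTensor (ModuleCat.{u} R)) (ComplexShape.down ℕ) i' j n') =
      (mulAux μ A (HomologicalComplex.ιMapBifunctorOrZero P.complex P.complex
        (curriedTensor (ModuleCat.{u} R)) (ComplexShape.down ℕ) i' j n')) ∘ₗ
        ((tensorComplex P A).d i i').hom :=
    mulAux_ext A fun p a q b => rfl
  exact congrArg (fun B => B x y) H

lemma mulAux_d₂ {i j j' n' : ℕ} (hj : j' + 1 = j) (x : (tensorComplex P A).X i)
    (y : (tensorComplex P A).X j) :
    ∃ ε : ℤˣ, mulAux μ A (HomologicalComplex.mapBifunctor.d₂ P.complex P.complex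
        (curriedTensor (ModuleCat.{u} R)) (ComplexShape.down ℕ) i j n') x y =
      ε • mulAux μ A (HomologicalComplex.ιMapBifunctorOrZero P.complex P.complex
        (curriedTensor (ModuleCat.{u} R)) (ComplexShape.down ℕ) i j' n')
        x ((tensorComplex P A).d j j' y) := by
  refine ⟨ComplexShape.ε₂ (ComplexShape.down ℕ) (ComplexShape.down ℕ) (ComplexShape.down ℕ) (i, j), ?_⟩
  rw [HomologicalComplex.mapBifunctor.d₂_eq' P.complex P.complex
    (curriedTensor (ModuleCat.{u} R)) (ComplexShape.down ℕ) i (i₂ := j) (i₂' := j') hj n']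
  refine (mulAux_units_smul μ A _ _ x y).trans (congrArg _ ?_)
  have H : mulAux μ A (((curriedTensor (ModuleCat.{u} R)).obj (P.complex.X i)).map
      (P.complex.d j j') ≫ HomologicalComplex.ιMapBifunctorOrZero P.complex P.complex
        (curriedTensor (ModuleCat.{u} R)) (ComplexShape.down ℕ) i j' n') =
      (mulAux μ A (HomologicalComplex.ιMapBifunctorOrZero P.complex P.complex
        (curriedTensor (ModuleCat.{u} R)) (ComplexShape.down ℕ) i j' n')).compl₂
        ((tensorComplex P A).d j j').hom :=
    mulAux_ext A fun p a q b => rfl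
  exact congrArg (fun B => B x y) H

lemma mulAux_d₁_of_cycle {i j n' : ℕ} (x : (tensorComplex P A).X i) (y : (tensorComplex P A).X j)
    (hx : (tensorComplex P A).d i ((ComplexShape.down ℕ).next i) x = 0) :
    mulAux μ A (HomologicalComplex.mapBifunctor.d₁ P.complex P.complex
        (curriedTensor (ModuleCat.{u} R)) (ComplexShape.down ℕ) i j n') x y = 0 := by
  by_cases hi : (ComplexShape.down ℕ).Rel i ((ComplexShape.down ℕ).next i)
  · obtain ⟨ε, h⟩ := mulAux_d₁ (n' := n') μ A hi x y
    rw [h, hx, map_zero, LinearMap.zero_apply, smul_zero]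
  · rw [HomologicalComplex.mapBifunctor.d₁_eq_zero _ _ _ _ _ _ _ hi]
    have H : mulAux μ A (0 : P.complex.X i ⊗ P.complex.X j ⟶
        (HomologicalComplex.tensorObj P.complex P.complex).X n') = 0 :=
      mulAux_ext A fun p a q b => (congrArg (fun z : P.complex.X n' => z ⊗ₜ[R] (a * b))
        (map_zero (μ.hom.f n').hom)).trans (TensorProduct.zero_tmul _ _)
    exact congrArg (fun B => B x y) H

lemma mulAux_d₂_of_cycle {i j n' : ℕ} (x : (tensorComplex P A).X i) (y : (tensorComplex P A).X j)
    (hy : (tensorComplex P A).d j ((ComplexShape.down ℕ).next j) y = 0) :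
    mulAux μ A (HomologicalComplex.mapBifunctor.d₂ P.complex P.complex
        (curriedTensor (ModuleCat.{u} R)) (ComplexShape.down ℕ) i j n') x y = 0 := by
  by_cases hj : (ComplexShape.down ℕ).Rel j ((ComplexShape.down ℕ).next j)
  · obtain ⟨ε, h⟩ := mulAux_d₂ (n' := n') μ A hj x y
    rw [h, hy, map_zero, smul_zero]
  · rw [HomologicalComplex.mapBifunctor.d₂_eq_zero _ _ _ _ _ _ _ hj]
    have H : mulAux μ A (0 : P.complex.X i ⊗ P.complex.X j ⟶
        (HomologicalComplex.tensorObj P.complex P.complex).X n') = 0 :=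
      mulAux_ext A fun p a q b => (congrArg (fun z : P.complex.X n' => z ⊗ₜ[R] (a * b))
        (map_zero (μ.hom.f n').hom)).trans (TensorProduct.zero_tmul _ _)
    exact congrArg (fun B => B x y) H

lemma mulChain_cycle {i j n n' : ℕ} (h : i + j = n) (x : (tensorComplex P A).X i)
    (y : (tensorComplex P A).X j)
    (hx : (tensorComplex P A).d i ((ComplexShape.down ℕ).next i) x = 0)
    (hy : (tensorComplex P A).d j ((ComplexShape.down ℕ).next j) y = 0) :
    (tensorComplex P A).d n n' (μ.mulChain A i j n h x y) = 0 := by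
  rw [mulAux_d, mulAux_d₁_of_cycle μ A x y hx, mulAux_d₂_of_cycle μ A x y hy, add_zero]

lemma mulChain_boundary_left {i i' j n n' : ℕ} (hi : i' + 1 = i) (h : i + j = n) (h' : i' + j = n')
    (x : (tensorComplex P A).X i) (y : (tensorComplex P A).X j)
    (hy : (tensorComplex P A).d j ((ComplexShape.down ℕ).next j) y = 0) :
    ∃ z, (tensorComplex P A).d n n' z =
      μ.mulChain A i' j n' h' ((tensorComplex P A).d i i' x) y := by
  obtain ⟨ε, hε⟩ := mulAux_d₁ (n' := n') μ A hi x y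
  have h1 := mulAux_d (n' := n') μ A h x y
  rw [mulAux_d₂_of_cycle μ A x y hy, add_zero, hε,
    HomologicalComplex.ιMapBifunctorOrZero_eq _ _ _ _ _ _ _ h'] at h1
  change _ = ε • μ.mulChain A i' j n' h' ((tensorComplex P A).d i i' x) y at h1
  obtain rfl | rfl := Int.units_eq_one_or ε
  · exact ⟨_, h1.trans (one_smul _ _)⟩
  · refine ⟨-_, (map_neg ((tensorComplex P A).d n n').hom _).trans ((congrArg Neg.neg h1).trans ?_)⟩
    rw [Units.neg_smul, one_smul, neg_neg]

lemma mulChain_boundary_right {i j j' n n' : ℕ} (hj : j' + 1 = j) (h : i + j = n)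
    (h' : i + j' = n') (x : (tensorComplex P A).X i) (y : (tensorComplex P A).X j)
    (hx : (tensorComplex P A).d i ((ComplexShape.down ℕ).next i) x = 0) :
    ∃ z, (tensorComplex P A).d n n' z =
      μ.mulChain A i j' n' h' x ((tensorComplex P A).d j j' y) := by
  obtain ⟨ε, hε⟩ := mulAux_d₂ (n' := n') μ A hj x y
  have h1 := mulAux_d (n' := n') μ A h x y
  rw [mulAux_d₁_of_cycle μ A x y hx, zero_add, hε,
    HomologicalComplex.ιMapBifunctorOrZero_eq _ _ _ _ _ _ _ h'] at h1
  change _ = ε • μ.mulChain A i j' n' h' x ((tensorComplex P A).d j j' y) at h1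
  obtain rfl | rfl := Int.units_eq_one_or ε
  · exact ⟨_, h1.trans (one_smul _ _)⟩
  · refine ⟨-_, (map_neg ((tensorComplex P A).d n n').hom _).trans ((congrArg Neg.neg h1).trans ?_)⟩
    rw [Units.neg_smul, one_smul, neg_neg]

end

/-- The cycles of degree `n` of a chain complex. -/
abbrev cyc (C : ChainComplex (ModuleCat.{u} R) ℕ) (n : ℕ) : Submodule R (C.X n) :=
  LinearMap.ker (C.sc n).g.hom

/-- The cycles which are boundaries. -/
abbrev bdry (C : ChainComplex (ModuleCat.{u} R) ℕ) (n : ℕ) : Submodule R (cyc C n) :=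
  LinearMap.range (C.sc n).moduleCatToCycles

/-- The homology of a chain complex of modules as cycles modulo boundaries. -/
def homologyEquiv (C : ChainComplex (ModuleCat.{u} R) ℕ) (n : ℕ) :
    C.homology n ≃ₗ[R] cyc C n ⧸ bdry C n :=
  (C.sc n).moduleCatHomologyIso.toLinearEquiv

section
variable {I : Ideal R} {P : Resolution I} (μ : ProductLift P) (A : Type u) [CommRing A]
  [Algebra R A]

/-- The product of cycles of `P ⊗ A`. -/
def mulCycles (i j : ℕ) : cyc (tensorComplex P A) i →ₗ[R] cyc (tensorComplex P A) j →ₗ[R]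
    cyc (tensorComplex P A) (i + j) :=
  LinearMap.mk₂ R (fun z w => ⟨μ.mulChain A i j (i + j) rfl z.1 w.1,
      mulChain_cycle μ A rfl z.1 w.1 z.2 w.2⟩)
    (fun _ _ _ => Subtype.ext (by simp)) (fun _ _ _ => Subtype.ext (by simp))
    (fun _ _ _ => Subtype.ext (by simp)) (fun _ _ _ => Subtype.ext (by simp))

lemma mulCycles_mem_bdry_left (i j : ℕ) (z : cyc (tensorComplex P A) i)
    (w : cyc (tensorComplex P A) j) (hz : z ∈ bdry (tensorComplex P A) i) :
    mulCycles μ A i j z w ∈ bdry (tensorComplex P A) (i + j) := by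
  obtain ⟨x, rfl⟩ := hz
  obtain ⟨v, hv⟩ := mulChain_boundary_left (n := (ComplexShape.down ℕ).prev (i + j)) μ A
    (show i + 1 = (ComplexShape.down ℕ).prev i by simp) (by simp; omega) rfl x w.1 w.2
  exact ⟨v, Subtype.ext hv⟩

lemma mulCycles_mem_bdry_right (i j : ℕ) (z : cyc (tensorComplex P A) i)
    (w : cyc (tensorComplex P A) j) (hw : w ∈ bdry (tensorComplex P A) j) :
    mulCycles μ A i j z w ∈ bdry (tensorComplex P A) (i + j) := by
  obtain ⟨y, rfl⟩ := hw
  obtain ⟨v, hv⟩ := mulChain_boundary_right (n := (ComplexShape.down ℕ).prev (i + j)) μ A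
    (show j + 1 = (ComplexShape.down ℕ).prev j by simp) (by simp; omega) rfl z.1 y z.2
  exact ⟨v, Subtype.ext hv⟩

/-- The product on cycles modulo boundaries of `P ⊗ A`. -/
def mulQuotient (i j : ℕ) :
    (cyc (tensorComplex P A) i ⧸ bdry (tensorComplex P A) i) →ₗ[R]
      (cyc (tensorComplex P A) j ⧸ bdry (tensorComplex P A) j) →ₗ[R]
        (cyc (tensorComplex P A) (i + j) ⧸ bdry (tensorComplex P A) (i + j)) :=
  Submodule.liftQ _
    { toFun := fun z => Submodule.mapQ _ _ (mulCycles μ A i j z)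
        (fun w hw => mulCycles_mem_bdry_right μ A i j z w hw)
      map_add' := fun z z' => by
        refine Submodule.linearMap_qext _ (LinearMap.ext fun w => ?_)
        exact congrArg Submodule.Quotient.mk ((mulCycles μ A i j).map_add₂ z z' w)
      map_smul' := fun r z => by
        refine Submodule.linearMap_qext _ (LinearMap.ext fun w => ?_)
        exact congrArg Submodule.Quotient.mk ((mulCycles μ A i j).map_smul₂ r z w) }
    (fun z hz => by
      refine LinearMap.mem_ker.2 (Submodule.linearMap_qext _ (LinearMap.ext fun w => ?_))
      exact (Submodule.Quotient.mk_eq_zero _).2 (mulCycles_mem_bdry_left μ A i j z w hz))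

/-- The internal product `Tor_i(R/I, A) × Tor_j(R/I, A) → Tor_{i+j}(R/I, A)` for an `R`-algebra `A`,
induced by the multiplications of `R/I` and of `A`. -/
def torMul (i j : ℕ) : tor I i A →ₗ[R] tor I j A →ₗ[R] tor I (i + j) A :=
  let e (n : ℕ) : tor I n A ≃ₗ[R] cyc (tensorComplex P A) n ⧸ bdry (tensorComplex P A) n :=
    (torIso P n A).toLinearEquiv ≪≫ₗ homologyEquiv (tensorComplex P A) n
  ((mulQuotient μ A i j).compl₁₂ (e i).toLinearMap (e j).toLinearMap).compr₂
    (e (i + j)).symm.toLinearMap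

end

end RegularQuotient

end

noncomputable section

namespace RegularQuotient

variable {R : Type u} [CommRing R]

/-! ### Functoriality and the long exact sequence of `Tor` -/

section LongExact

variable {I : Ideal R} {M N L : Type u} [AddCommGroup M] [Module R M] [AddCommGroup N]
  [Module R N] [AddCommGroup L] [Module R L]

/-! Everything rests on one fact: the inclusion `I^(s+1) → I^s` induces zero on `Tor_*(R/I, -)`. The
predicate `TorLinear` is a form of this that can be proved by adjoining one element of the regular
sequence at a time. Its generation clause gives the vanishing in `TorLinear.torMap_powIncl`:
multiplication by `a ∈ J` into `J^(s+2)`, followed by the inclusion back into `J^(s+1)`, is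
multiplication by an element of `I`, which kills `Tor`. The clause concerns only powers at least
`2`, because `Tor_n(R/I, R)` vanishes for `n > 0` and cannot generate `Tor_n(R/I, J)`; the inclusion
`J → R` is handled by the augmentation instead. The ideal `I ⊇ J` is left arbitrary because it stays
fixed while `J` grows.

For `K = J + (r)` with `r` regular on `R/J`, the induction uses the exact sequence `0 → J^(s+1) →
J^(s+1) × K^s → K^(s+1) → 0` with maps `x ↦ (-rx, x)` and `(x, y) ↦ x + ry`. The first map is zero
on `Tor`, so the long exact sequence breaks into short ones, from which both clauses pass from `J`
to `K` (`TorLinear.free_sup`, `TorLinear.gen_sup`).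

For the theorem, the vanishing makes every connecting map `Tor_(n+1)(R/I, I^a/I^(a+1)) → Tor_n(R/I,
I^(a+1))` surjective, while reduced `Tor_(n+1)(R/I, R/I^s)` is `Tor_n(R/I, I^s)`. Freeness follows
at once, and exactness follows by comparing long exact sequences. Finally, every reduced class comes
from `Tor(R/I, I^(s-1)/I^s)`, so it has a cycle with coefficients in `I^(s-1)/I^s`; a product of two
such cycles has coefficients in `I^(2s-2) ⊆ I^s`, hence is already zero on chains. -/

@[simp]
lemma torMap_id (n : ℕ) : torMap I n (LinearMap.id : M →ₗ[R] M) = LinearMap.id :=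
  congrArg ModuleCat.Hom.hom (CategoryTheory.Functor.map_id
    ((Tor' (ModuleCat.{u} R) n).obj (ModuleCat.of R (R ⧸ I))) (ModuleCat.of R M))

lemma torMap_comp (n : ℕ) (g : N →ₗ[R] L) (f : M →ₗ[R] N) :
    torMap I n (g ∘ₗ f) = torMap I n g ∘ₗ torMap I n f :=
  congrArg ModuleCat.Hom.hom (CategoryTheory.Functor.map_comp
    ((Tor' (ModuleCat.{u} R) n).obj (ModuleCat.of R (R ⧸ I))) (ModuleCat.ofHom f)
    (ModuleCat.ofHom g))

lemma torMap_torMap (n : ℕ) (g : N →ₗ[R] L) (f : M →ₗ[R] N) (x : tor I n M) :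
    torMap I n g (torMap I n f x) = torMap I n (g ∘ₗ f) x := by
  rw [torMap_comp, LinearMap.comp_apply]

lemma torMap_apply (P : Resolution I) (n : ℕ) (f : M →ₗ[R] N) (x : tor I n M) :
    torMap I n f x = (torIso P n N).inv.hom
      ((HomologicalComplex.homologyMap (tensorComplexMap P f) n).hom ((torIso P n M).hom.hom x)) :=
  congrArg (fun φ => φ.hom x) (torMap_eq P n f)

lemma tensorComplexMap_add (P : Resolution I) (f g : M →ₗ[R] N) :
    tensorComplexMap P (f + g) = tensorComplexMap P f + tensorComplexMap P g := by
  ext i : 1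
  refine ModuleCat.hom_ext ?_
  exact LinearMap.lTensor_add (P.complex.X i) f g

lemma tensorComplexMap_smul (P : Resolution I) (r : R) (f : M →ₗ[R] N) :
    tensorComplexMap P (r • f) = r • tensorComplexMap P f := by
  ext i : 1
  refine ModuleCat.hom_ext ?_
  exact LinearMap.lTensor_smul (P.complex.X i) r f

lemma torMap_add (n : ℕ) (f g : M →ₗ[R] N) :
    torMap I n (f + g) = torMap I n f + torMap I n g := by
  let P : Resolution I := projectiveResolution _
  have h : ModuleCat.ofHom (torMap I n (f + g)) =
      ModuleCat.ofHom (torMap I n f) + ModuleCat.ofHom (torMap I n g) := by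
    rw [torMap_eq P, torMap_eq P, torMap_eq P, tensorComplexMap_add,
      HomologicalComplex.homologyMap_add]
    simp only [Preadditive.add_comp, Preadditive.comp_add]
  exact congrArg ModuleCat.Hom.hom h

lemma torMap_smul (n : ℕ) (r : R) (f : M →ₗ[R] N) :
    torMap I n (r • f) = r • torMap I n f := by
  let P : Resolution I := projectiveResolution _
  have h : ModuleCat.ofHom (torMap I n (r • f)) = r • ModuleCat.ofHom (torMap I n f) := by
    have h1 : HomologicalComplex.homologyMap (r • tensorComplexMap P f) n =
        r • HomologicalComplex.homologyMap (tensorComplexMap P f) n :=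
      ShortComplex.homologyMap_smul
        ((HomologicalComplex.shortComplexFunctor (ModuleCat.{u} R) (ComplexShape.down ℕ) n).map
          (tensorComplexMap P f)) r
    rw [torMap_eq P, torMap_eq P, tensorComplexMap_smul, h1]
    simp only [Linear.smul_comp, Linear.comp_smul]
  exact congrArg ModuleCat.Hom.hom h

lemma torMap_zero (n : ℕ) : torMap I n (0 : M →ₗ[R] N) = 0 := by
  rw [← zero_smul R (0 : M →ₗ[R] N), torMap_smul, zero_smul]

lemma torMap_smul_eq_zero (n : ℕ) {r : R} (hr : r ∈ I) (f : M →ₗ[R] N) :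
    torMap I n (r • f) = 0 := by
  rw [torMap_smul]
  exact LinearMap.ext fun x => smul_tor_eq_zero I n N r hr _

/-- The functor `M ↦ P ⊗ M` applied to a short exact sequence. -/
def tensorSeq (P : Resolution I) (f : M →ₗ[R] N) (g : N →ₗ[R] L) (hfg : Function.Exact f g) :
    ShortComplex (ChainComplex (ModuleCat.{u} R) ℕ) where
  X₁ := tensorComplex P M
  X₂ := tensorComplex P N
  X₃ := tensorComplex P L
  f := tensorComplexMap P f
  g := tensorComplexMap P g
  zero := by
    ext i : 1
    refine ModuleCat.hom_ext ?_
    refine TensorProduct.ext' fun p x => ?_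
    exact (congrArg (fun y => p ⊗ₜ[R] y) (hfg.apply_apply_eq_zero x)).trans
      (TensorProduct.tmul_zero _ _)

lemma tensorSeq_shortExact (P : Resolution I) {f : M →ₗ[R] N} {g : N →ₗ[R] L}
    (hf : Function.Injective f) (hfg : Function.Exact f g) (hg : Function.Surjective g) :
    (tensorSeq P f g hfg).ShortExact := by
  refine HomologicalComplex.shortExact_of_degreewise_shortExact _ fun i => ?_
  have : Module.Projective R (P.complex.X i) :=
    (IsProjective.iff_projective _).2 (P.projective i)
  refine ModuleCat.shortComplex_shortExact _ ?_ ?_ ?_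
  · exact lTensor_exact (P.complex.X i) hfg hg
  · exact Module.Flat.lTensor_preserves_injective_linearMap _ hf
  · exact LinearMap.lTensor_surjective (P.complex.X i) hg

/-- The connecting homomorphism `Tor_{n+1}(R/I, L) → Tor_n(R/I, M)` of a short exact sequence
`0 → M → N → L → 0`. -/
def torδ (P : Resolution I) {f : M →ₗ[R] N} {g : N →ₗ[R] L} (hf : Function.Injective f)
    (hfg : Function.Exact f g) (hg : Function.Surjective g) (n : ℕ) :
    tor I (n + 1) L →ₗ[R] tor I n M :=
  ((torIso P (n + 1) L).hom ≫ (tensorSeq_shortExact P hf hfg hg).δ (n + 1) n rfl ≫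
    (torIso P n M).inv).hom

lemma connecting_eq_torδ (P : Resolution I) {a b c : ℕ} (hab : a ≤ b) (hbc : b ≤ c) (n : ℕ) :
    connecting P hab hbc n = torδ P (powQuot_exact I hab hbc).1 (powQuot_exact I hab hbc).2.1
      (powQuot_exact I hab hbc).2.2 n := rfl

section

variable (P : Resolution I) {f : M →ₗ[R] N} {g : N →ₗ[R] L} (hf : Function.Injective f)
  (hfg : Function.Exact f g) (hg : Function.Surjective g) (n : ℕ)

/-- Carries the homology sequence of `P ⊗ -` over to `tor` along the isomorphisms `torIso`. -/
lemma exact_of_conj {A B C A' B' C' : ModuleCat.{u} R} (eA : A ≅ A') (eB : B ≅ B') (eC : C ≅ C')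
    {S : A' ⟶ B'} {T : B' ⟶ C'} (w : S ≫ T = 0) (h : (ShortComplex.mk S T w).Exact)
    {S' : A ⟶ B} {T' : B ⟶ C} (hS : S' = eA.hom ≫ S ≫ eB.inv) (hT : T' = eB.hom ≫ T ≫ eC.inv) :
    Function.Exact S'.hom T'.hom := by
  have w' : S' ≫ T' = 0 := by simp [hS, hT, reassoc_of% w]
  have h' : (ShortComplex.mk S' T' w').Exact :=
    ShortComplex.exact_of_iso (ShortComplex.isoMk eA.symm eB.symm eC.symm
      (by simp [hS]) (by simp [hT])) h
  exact (ShortComplex.ShortExact.moduleCat_exact_iff_function_exact _).1 h'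

include hf hfg hg

lemma torMap_exact : Function.Exact (torMap I n f) (torMap I n g) :=
  let P : Resolution I := projectiveResolution _
  exact_of_conj (torIso P n M) (torIso P n N) (torIso P n L) _
    ((tensorSeq_shortExact P hf hfg hg).homology_exact₂ n) (torMap_eq P n f) (torMap_eq P n g)

lemma torMap_torδ_exact : Function.Exact (torMap I (n + 1) g) (torδ P hf hfg hg n) :=
  exact_of_conj (torIso P (n + 1) N) (torIso P (n + 1) L) (torIso P n M) _
    ((tensorSeq_shortExact P hf hfg hg).homology_exact₃ (n + 1) n rfl) (torMap_eq P (n + 1) g) rfl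

lemma torδ_torMap_exact : Function.Exact (torδ P hf hfg hg n) (torMap I n f) :=
  exact_of_conj (torIso P (n + 1) L) (torIso P n M) (torIso P n N) _
    ((tensorSeq_shortExact P hf hfg hg).homology_exact₁ (n + 1) n rfl) rfl (torMap_eq P n f)

end

/-- Right exactness of the tensor product: no differential leaves degree `0`, so a surjection on
chains there stays surjective on homology. -/
lemma torMap_zero_surjective {g : N →ₗ[R] L} (hg : Function.Surjective g) :
    Function.Surjective (torMap I 0 g) := by
  let P : Resolution I := projectiveResolution _
  have h0 : Epi ((tensorComplexMap P g).f 0) :=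
    (ModuleCat.epi_iff_surjective _).2 (LinearMap.lTensor_surjective (P.complex.X 0) hg)
  have h1 : Epi (HomologicalComplex.homologyMap (tensorComplexMap P g) 0) :=
    HomologicalComplex.epi_homologyMap_of_epi_of_not_rel _ _ (by simp)
  have h2 : Epi (ModuleCat.ofHom (torMap I 0 g)) := by
    rw [torMap_eq P]
    infer_instance
  exact (ModuleCat.epi_iff_surjective _).1 h2

lemma conj_comm {A B C D A' B' C' D' : ModuleCat.{u} R} (eA : A ≅ A') (eB : B ≅ B') (eC : C ≅ C')
    (eD : D ≅ D') {S : A' ⟶ B'} {T : C' ⟶ D'} {φ : B' ⟶ D'} {ψ : A' ⟶ C'} (h : S ≫ φ = ψ ≫ T)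
    {φ' : B ⟶ D} {ψ' : A ⟶ C} (hφ : φ' = eB.hom ≫ φ ≫ eD.inv) (hψ : ψ' = eA.hom ≫ ψ ≫ eC.inv) :
    (eA.hom ≫ S ≫ eB.inv) ≫ φ' = ψ' ≫ eC.hom ≫ T ≫ eD.inv := by
  simp [hφ, hψ, reassoc_of% h]

/-- The connecting homomorphism is natural in the short exact sequence. -/
lemma torδ_naturality (P : Resolution I) {M' N' L' : Type u} [AddCommGroup M'] [Module R M']
    [AddCommGroup N'] [Module R N'] [AddCommGroup L'] [Module R L']
    {f : M →ₗ[R] N} {g : N →ₗ[R] L} (hf : Function.Injective f)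
    (hfg : Function.Exact f g) (hg : Function.Surjective g)
    {f' : M' →ₗ[R] N'} {g' : N' →ₗ[R] L'} (hf' : Function.Injective f')
    (hfg' : Function.Exact f' g') (hg' : Function.Surjective g')
    (φ : M →ₗ[R] M') (χ : N →ₗ[R] N') (ψ : L →ₗ[R] L') (h1 : χ ∘ₗ f = f' ∘ₗ φ)
    (h2 : ψ ∘ₗ g = g' ∘ₗ χ) (n : ℕ) (x : tor I (n + 1) L) :
    torMap I n φ (torδ P hf hfg hg n x) = torδ P hf' hfg' hg' n (torMap I (n + 1) ψ x) := by
  have hcomp {A B C : Type u} [AddCommGroup A] [Module R A] [AddCommGroup B] [Module R B]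
      [AddCommGroup C] [Module R C] (v : B →ₗ[R] C) (u : A →ₗ[R] B) :
      tensorComplexMap P (v ∘ₗ u) = tensorComplexMap P u ≫ tensorComplexMap P v := by
    ext i : 1
    refine ModuleCat.hom_ext ?_
    exact LinearMap.lTensor_comp (P.complex.X i) v u
  let Φ : tensorSeq P f g hfg ⟶ tensorSeq P f' g' hfg' :=
    { τ₁ := tensorComplexMap P φ
      τ₂ := tensorComplexMap P χ
      τ₃ := tensorComplexMap P ψ
      comm₁₂ := (hcomp f' φ).symm.trans ((congrArg _ h1.symm).trans (hcomp χ f))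
      comm₂₃ := (hcomp g' χ).symm.trans ((congrArg _ h2.symm).trans (hcomp ψ g)) }
  have h := HomologicalComplex.HomologySequence.δ_naturality Φ (tensorSeq_shortExact P hf hfg hg)
    (tensorSeq_shortExact P hf' hfg' hg') (n + 1) n rfl
  exact congrArg (fun φ => φ.hom x) (conj_comm (torIso P (n + 1) L) (torIso P n M)
    (torIso P (n + 1) L') (torIso P n M') h (torMap_eq P n φ) (torMap_eq P (n + 1) ψ))

end LongExact

/-! ### Modules that are free over `R/I` -/

section Free

lemma free_of_linearEquiv (I : Ideal R) {M N : Type u} [AddCommGroup M] [Module R M]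
    [AddCommGroup N] [Module R N] [Module (R ⧸ I) M] [Module (R ⧸ I) N]
    [IsScalarTower R (R ⧸ I) M] [IsScalarTower R (R ⧸ I) N] (e : M ≃ₗ[R] N)
    (h : Module.Free (R ⧸ I) M) : Module.Free (R ⧸ I) N :=
  Module.Free.of_equiv (e.extendScalarsOfSurjective (S := R ⧸ I) Ideal.Quotient.mk_surjective)

/-- The quotient term is projective, so the sequence splits and the middle term is a product of free
modules. -/
lemma free_of_shortExact {S : Type u} [CommRing S] {M N L : Type u} [AddCommGroup M] [Module S M]
    [AddCommGroup N] [Module S N] [AddCommGroup L] [Module S L] {f : M →ₗ[S] N} {g : N →ₗ[S] L}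
    (hf : Function.Injective f) (hfg : Function.Exact f g) (hg : Function.Surjective g)
    (hM : Module.Free S M) (hL : Module.Free S L) : Module.Free S N := by
  obtain ⟨l, hl⟩ := Module.projective_lifting_property g LinearMap.id hg
  exact Module.Free.of_equiv (hfg.splitSurjectiveEquiv hf ⟨l, hl⟩).1.symm

lemma free_of_shortExact_quotient (I : Ideal R) {M N L : Type u} [AddCommGroup M] [Module R M]
    [AddCommGroup N] [Module R N] [AddCommGroup L] [Module R L] [Module (R ⧸ I) M]
    [Module (R ⧸ I) N] [Module (R ⧸ I) L] [IsScalarTower R (R ⧸ I) M]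
    [IsScalarTower R (R ⧸ I) N] [IsScalarTower R (R ⧸ I) L] {f : M →ₗ[R] N} {g : N →ₗ[R] L}
    (hf : Function.Injective f) (hfg : Function.Exact f g) (hg : Function.Surjective g)
    (hM : Module.Free (R ⧸ I) M) (hL : Module.Free (R ⧸ I) L) : Module.Free (R ⧸ I) N :=
  have hs : Function.Surjective (algebraMap R (R ⧸ I)) := Ideal.Quotient.mk_surjective
  free_of_shortExact (f := f.extendScalarsOfSurjective hs) (g := g.extendScalarsOfSurjective hs)
    hf hfg hg hM hL

lemma isSMulRegular_of_free (I : Ideal R) {M : Type u} [AddCommGroup M] [Module R M]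
    [Module (R ⧸ I) M] [IsScalarTower R (R ⧸ I) M] (h : Module.Free (R ⧸ I) M) {r : R}
    (hr : IsSMulRegular (R ⧸ I) r) : IsSMulRegular M r := by
  intro x y hxy
  let b := Module.Free.chooseBasis (R ⧸ I) M
  refine b.repr.injective (Finsupp.ext fun i => hr ?_)
  have h1 (z : M) : r • b.repr z i = b.repr (r • z) i := by
    rw [← algebraMap_smul (R ⧸ I) r z, map_smul, Finsupp.smul_apply, algebraMap_smul]
  change r • b.repr x i = r • b.repr y i
  rw [h1, h1]
  exact congrArg (fun z => b.repr z i) hxy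

end Free

/-! ### Elementary values of `Tor`: degree zero, coefficients in `R`, products -/

section Computations

variable {I : Ideal R}

/-- `Tor_0(R/I, M) = M/IM`. -/
def torZeroEquiv (I : Ideal R) (M : Type u) [AddCommGroup M] [Module R M] :
    tor I 0 M ≃ₗ[R] M ⧸ (I • ⊤ : Submodule R M) :=
  (((tensoringRight (ModuleCat.{u} R)).obj (ModuleCat.of R M)).leftDerivedZeroIsoSelf.app
    (ModuleCat.of R (R ⧸ I))).toLinearEquiv ≪≫ₗ TensorProduct.quotTensorEquivQuotSMul M I

/-- The augmentation is a left inverse up to isomorphism. -/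
lemma torUnit_injective {J : Ideal R} (hJ : J ≤ I) (n : ℕ) :
    Function.Injective (torUnit I J n) :=
  Function.Injective.of_comp
    (f := augmentation (projectiveResolution _ : Resolution I) hJ n)
    (augmentation_torUnit_bijective (projectiveResolution _ : Resolution I) hJ n).1

lemma tor_subsingleton (n : ℕ) (M : Type u) [AddCommGroup M] [Module R M] [Subsingleton M] :
    Subsingleton (tor I n M) := by
  refine subsingleton_of_forall_eq 0 fun x => ?_
  have h : torMap I n (LinearMap.id : M →ₗ[R] M) x = 0 := by
    rw [Subsingleton.elim (LinearMap.id : M →ₗ[R] M) 0, torMap_zero, LinearMap.zero_apply]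
  rwa [torMap_id] at h

/-- Composing with the augmentation for `J = I` identifies this module with `R/I` in degree `0` and
with zero in positive degrees. -/
lemma tor_self_free (I : Ideal R) (n : ℕ) : Module.Free (R ⧸ I) (tor I n R) := by
  let P : Resolution I := projectiveResolution _
  let e := LinearEquiv.ofBijective _ (augmentation_torUnit_bijective P le_rfl n)
  cases n with
  | zero =>
    let e' : tor I 0 R ≃ₗ[R] R ⧸ I :=
      e ≪≫ₗ ((HomologicalComplex.homologyFunctorSingleIso (ModuleCat.{u} R)
      (ComplexShape.down ℕ) 0).app (ModuleCat.of R (R ⧸ I))).toLinearEquiv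
    have h : Module.Free (R ⧸ I) (R ⧸ I) := inferInstance
    exact free_of_linearEquiv I (N := tor I 0 R) e'.symm h
  | succ n =>
    have h0 : Limits.IsZero (((ChainComplex.single₀ (ModuleCat.{u} R)).obj
        (ModuleCat.of R (R ⧸ I))).homology (n + 1)) :=
      HomologicalComplex.isZero_single_obj_homology _ _ _ _ (by simp)
    have h1 := ModuleCat.subsingleton_of_isZero h0
    have := e.toEquiv.subsingleton
    infer_instance

/-- `Tor_n(R/I, M × N) = Tor_n(R/I, M) × Tor_n(R/I, N)`. -/
def torProd (I : Ideal R) (n : ℕ) (M N : Type u) [AddCommGroup M] [Module R M] [AddCommGroup N]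
    [Module R N] : tor I n (M × N) ≃ₗ[R] tor I n M × tor I n N :=
  LinearEquiv.ofLinearMap
    ((torMap I n (LinearMap.fst R M N)).prod (torMap I n (LinearMap.snd R M N)))
    ((torMap I n (LinearMap.inl R M N)).coprod (torMap I n (LinearMap.inr R M N)))
    (by
      refine LinearMap.ext fun x => Prod.ext ?_ ?_
      · simp [torMap_torMap, torMap_zero]
      · simp [torMap_torMap, torMap_zero])
    (by
      refine LinearMap.ext fun x => ?_
      have h := congrArg (fun f => f x) (torMap_add (I := I) n
        (LinearMap.inl R M N ∘ₗ LinearMap.fst R M N) (LinearMap.inr R M N ∘ₗ LinearMap.snd R M N))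
      have h' : LinearMap.inl R M N ∘ₗ LinearMap.fst R M N +
        LinearMap.inr R M N ∘ₗ LinearMap.snd R M N = LinearMap.id := by ext <;> simp
      rw [h', torMap_id] at h
      simp [torMap_torMap] at h ⊢
      exact h.symm)

end Computations

/-! ### Powers of an ideal and `Tor` -/

/-- Multiplication by `a ∈ J` as a map `J^s → J^(s+1)`. -/
abbrev mulPow (J : Ideal R) (a : J) (s : ℕ) : ↥(J ^ s) →ₗ[R] ↥(J ^ (s + 1)) :=
  (LinearMap.mulLeft R (a : R)).restrict fun x hx => by
    rw [pow_succ']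
    exact Ideal.mul_mem_mul a.2 hx

/-- The inclusion `J^(s+1) → J^s`. -/
abbrev powIncl (J : Ideal R) (s : ℕ) : ↥(J ^ (s + 1)) →ₗ[R] ↥(J ^ s) :=
  Submodule.inclusion (Ideal.pow_le_pow_right s.le_succ)

/-- For all ideals `I` containing `J`, the modules `Tor_n(R/I, J^s)` are free over `R/I` and, for
`s ≥ 2`, generated by the products of elements of `J` with `Tor_n(R/I, J^(s-1))`. -/
structure TorLinear (J : Ideal R) : Prop where
  free : ∀ I : Ideal R, J ≤ I → ∀ n s : ℕ, Module.Free (R ⧸ I) (tor I n ↥(J ^ s))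
  gen : ∀ I : Ideal R, J ≤ I → ∀ n s : ℕ,
    ⨆ a : J, LinearMap.range (torMap I n (mulPow J a (s + 1))) = ⊤

/-- In the long exact sequence of `0 → J → R → R/J → 0` the next map, `torUnit`, is injective. -/
lemma torMap_subtype_eq_zero {I J : Ideal R} (hJ : J ≤ I) (n : ℕ) :
    torMap I n J.subtype = 0 := by
  refine LinearMap.ext fun x => torUnit_injective hJ n ?_
  rw [LinearMap.zero_apply, map_zero]
  exact (torMap_exact J.injective_subtype (LinearMap.exact_subtype_mkQ J) J.mkQ_surjective
    n).apply_apply_eq_zero x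

/-- The vanishing on which the whole argument turns. For positive `s` it suffices to test on the
generators `a · v`; including such a product back into the lower power is multiplication by `a ∈ I`,
which acts as zero on `Tor`. -/
lemma TorLinear.torMap_powIncl {J : Ideal R} (h : TorLinear J) {I : Ideal R} (hJ : J ≤ I)
    (n s : ℕ) : torMap I n (powIncl J s) = 0 := by
  cases s with
  | zero =>
    have h1 : powIncl J 0 = LinearMap.id.codRestrict (J ^ 0) (by simp) ∘ₗ (J ^ (0 + 1)).subtype :=
      rfl
    rw [h1, torMap_comp, torMap_subtype_eq_zero (by simpa using hJ), LinearMap.comp_zero]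
  | succ s =>
    rw [← LinearMap.ker_eq_top, eq_top_iff, ← h.gen I hJ n s, iSup_le_iff]
    rintro a _ ⟨x, rfl⟩
    have h1 : powIncl J (s + 1) ∘ₗ mulPow J a (s + 1) = (a : R) • LinearMap.id := rfl
    rw [LinearMap.mem_ker, torMap_torMap, h1, torMap_smul_eq_zero n (hJ a.2), LinearMap.zero_apply]

/-- Start of the induction: the zeroth power is `R` and all others vanish. -/
lemma torLinear_bot : TorLinear (⊥ : Ideal R) where
  free I _ n s := by
    cases s with
    | zero =>
      have e : (⊤ : Ideal R) ≃ₗ[R] R := Submodule.topEquiv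
      rw [pow_zero, Ideal.one_eq_top]
      refine free_of_linearEquiv I (LinearEquiv.ofLinearMap (torMap I n e.symm.toLinearMap)
        (torMap I n e.toLinearMap) ?_ ?_) (tor_self_free I n)
      all_goals rw [← torMap_comp]; simp
    | succ s =>
      rw [Ideal.bot_pow s.succ_ne_zero]
      have := tor_subsingleton (I := I) n (⊥ : Ideal R)
      infer_instance
  gen I _ n s := by
    have : Subsingleton ↥((⊥ : Ideal R) ^ (s + 1 + 1)) := by
      rw [Ideal.bot_pow (s + 1).succ_ne_zero]
      infer_instance
    have := tor_subsingleton (I := I) n ↥((⊥ : Ideal R) ^ (s + 1 + 1))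
    exact Subsingleton.elim _ _

/-- Freeness in degree `0` for `I = J` says that `J^s/J^(s+1)` is free over `R/J`, so `r` is regular
on each graded piece. Induction along the `J`-adic filtration then makes `r` regular modulo every
power of `J`. -/
lemma TorLinear.mem_pow_of_mul_mem {J : Ideal R} (h : TorLinear J) {r : R}
    (hr : IsSMulRegular (R ⧸ J) r) (s : ℕ) {x : R} (hx : r * x ∈ J ^ s) : x ∈ J ^ s := by
  induction s with
  | zero => simp
  | succ s ih =>
    have hx' : x ∈ J ^ s := ih (Ideal.pow_le_pow_right s.le_succ hx)
    have h1 := ((torZeroEquiv J ↥(J ^ s)).isSMulRegular_congr r).1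
      (isSMulRegular_of_free J (h.free J le_rfl 0 s) hr)
    have h2 := isSMulRegular_iff_right_eq_zero_of_smul.1 h1
      (Submodule.Quotient.mk (⟨x, hx'⟩ : ↥(J ^ s))) (by
        rw [← Submodule.Quotient.mk_smul, Submodule.Quotient.mk_eq_zero,
          Submodule.mem_smul_top_iff, smul_eq_mul, ← pow_succ']
        exact hx)
    rwa [Submodule.Quotient.mk_eq_zero, Submodule.mem_smul_top_iff, smul_eq_mul, ← pow_succ'] at h2

/-- With `K = J + (r)`, split one factor off: `K^(s+2) = J K^(s+1) + r K^(s+1)`. Inductively the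
first summand lies in `J^(s+2) + r J K^s`, and `J K^s ⊆ K^(s+1)`. -/
lemma sup_span_singleton_pow_succ_le (J : Ideal R) (r : R) (s : ℕ) :
    (J ⊔ Ideal.span {r}) ^ (s + 1) ≤ J ^ (s + 1) ⊔ Ideal.span {r} * (J ⊔ Ideal.span {r}) ^ s := by
  set K := J ⊔ Ideal.span {r}
  induction s with
  | zero => simp [K]
  | succ s ih =>
    have h1 : K ^ (s + 1 + 1) = J * K ^ (s + 1) ⊔ Ideal.span {r} * K ^ (s + 1) := by
      rw [pow_succ', ← Ideal.sup_mul]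
    rw [h1]
    refine sup_le ((Ideal.mul_mono_right ih).trans ?_) le_sup_right
    rw [Ideal.mul_sup, ← pow_succ', mul_left_comm, pow_succ' K s]
    exact sup_le_sup_left (Ideal.mul_mono_right (Ideal.mul_mono_left le_sup_left)) _

/-! ### Adjoining one regular element: from `J` to `J + (r)` -/

section Step

variable {J : Ideal R} {r : R}

/-- The map `J^(s+1) → J^(s+1) × K^s`, `x ↦ (-rx, x)`, where `J ≤ K`. -/
abbrev relMap (J : Ideal R) (r : R) (s : ℕ) :
    ↥(J ^ (s + 1)) →ₗ[R] ↥(J ^ (s + 1)) × ↥((J ⊔ Ideal.span {r}) ^ s) :=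
  ((-r) • LinearMap.id).prod (Submodule.inclusion
    ((Ideal.pow_le_pow_right s.le_succ).trans (Ideal.pow_right_mono le_sup_left s)))

/-- The element `r` of `J + (r)`. -/
abbrev supGen (J : Ideal R) (r : R) : ↥(J ⊔ Ideal.span {r}) :=
  ⟨r, Ideal.mem_sup_right (Ideal.mem_span_singleton_self r)⟩

/-- The map `J^(s+1) × K^s → K^(s+1)`, `(x, y) ↦ x + ry`, where `K = J + (r)`. -/
abbrev genMap (J : Ideal R) (r : R) (s : ℕ) :
    ↥(J ^ (s + 1)) × ↥((J ⊔ Ideal.span {r}) ^ s) →ₗ[R] ↥((J ⊔ Ideal.span {r}) ^ (s + 1)) :=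
  (Submodule.inclusion (Ideal.pow_right_mono le_sup_left (s + 1))).coprod
    (mulPow (J ⊔ Ideal.span {r}) (supGen J r) s)

lemma relMap_injective (s : ℕ) : Function.Injective (relMap J r s) := fun _ _ hxy =>
  Subtype.ext (congrArg (fun z => (z.2 : R)) hxy)

lemma genMap_surjective (s : ℕ) : Function.Surjective (genMap J r s) := by
  intro z
  obtain ⟨x, hx, w, hw, hz⟩ := Submodule.mem_sup.1 (sup_span_singleton_pow_succ_le J r s z.2)
  obtain ⟨y, hy, rfl⟩ := Ideal.mem_span_singleton_mul.1 hw
  exact ⟨(⟨x, hx⟩, ⟨y, hy⟩), Subtype.ext hz⟩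

/-- If `x + ry = 0` with `x ∈ J^(s+1)`, regularity of `r` modulo `J^(s+1)` forces `y ∈ J^(s+1)`, and
then `y` itself is the preimage. -/
lemma relMap_genMap_exact (h : TorLinear J) (hr : IsSMulRegular (R ⧸ J) r) (s : ℕ) :
    Function.Exact (relMap J r s) (genMap J r s) := by
  rintro ⟨x, y⟩
  constructor
  · intro hxy
    have hxy : (x : R) + r * (y : R) = 0 := congrArg Subtype.val hxy
    have hx : (x : R) = -r * (y : R) := by linear_combination hxy
    have hy : (y : R) ∈ J ^ (s + 1) := h.mem_pow_of_mul_mem hr (s + 1) (by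
      rw [show r * (y : R) = -(x : R) by linear_combination hxy]
      exact neg_mem x.2)
    exact ⟨⟨y, hy⟩, Prod.ext (Subtype.ext hx.symm) rfl⟩
  · rintro ⟨z, hz⟩
    rw [← hz]
    refine Subtype.ext ?_
    change -r * (z : R) + r * (z : R) = 0
    ring

/-- Both components die on `Tor`: the first is multiplication by `-r ∈ I`, and the second factors
through `J^(s+1) → J^s`. -/
lemma TorLinear.torMap_relMap (h : TorLinear J) {I : Ideal R} (hJ : J ⊔ Ideal.span {r} ≤ I)
    (n s : ℕ) : torMap I n (relMap J r s) = 0 := by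
  refine LinearMap.ext fun x => (torProd I n _ _).injective (Prod.ext ?_ ?_)
  · have h1 : torMap I n (LinearMap.fst R ↥(J ^ (s + 1)) ↥((J ⊔ Ideal.span {r}) ^ s))
        (torMap I n (relMap J r s) x) = 0 := by
      rw [torMap_torMap, LinearMap.fst_prod,
        torMap_smul_eq_zero n (neg_mem (hJ (supGen J r).2)), LinearMap.zero_apply]
    rw [LinearMap.zero_apply, map_zero]
    exact h1
  · have h1 : torMap I n (LinearMap.snd R ↥(J ^ (s + 1)) ↥((J ⊔ Ideal.span {r}) ^ s))
        (torMap I n (relMap J r s) x) = 0 := by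
      rw [torMap_torMap, LinearMap.snd_prod,
        show Submodule.inclusion ((Ideal.pow_le_pow_right s.le_succ).trans
          (Ideal.pow_right_mono (le_sup_left : J ≤ J ⊔ Ideal.span {r}) s)) =
          Submodule.inclusion (Ideal.pow_right_mono le_sup_left s) ∘ₗ powIncl J s from rfl,
        torMap_comp, h.torMap_powIncl (le_sup_left.trans hJ), LinearMap.comp_zero,
        LinearMap.zero_apply]
    rw [LinearMap.zero_apply, map_zero]
    exact h1

lemma TorLinear.torMap_genMap_injective (h : TorLinear J) (hr : IsSMulRegular (R ⧸ J) r)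
    {I : Ideal R} (hJ : J ⊔ Ideal.span {r} ≤ I) (n s : ℕ) :
    Function.Injective (torMap I n (genMap J r s)) := by
  rw [injective_iff_map_eq_zero]
  intro x hx
  obtain ⟨y, rfl⟩ := (torMap_exact (relMap_injective s) (relMap_genMap_exact h hr s)
    (genMap_surjective s) n x).1 hx
  rw [h.torMap_relMap hJ, LinearMap.zero_apply]

lemma TorLinear.torδ_surjective (h : TorLinear J) (hr : IsSMulRegular (R ⧸ J) r)
    {I : Ideal R} (P : Resolution I) (hJ : J ⊔ Ideal.span {r} ≤ I) (n s : ℕ) :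
    Function.Surjective (torδ P (relMap_injective s) (relMap_genMap_exact h hr s)
      (genMap_surjective s) n) := fun x =>
  (torδ_torMap_exact P (relMap_injective s) (relMap_genMap_exact h hr s)
    (genMap_surjective s) n x).1 (by rw [h.torMap_relMap hJ, LinearMap.zero_apply])

/-- With `K = J + (r)`, the long exact sequence yields `0 → Tor_n(J^(s+1)) × Tor_n(K^s) →
Tor_n(K^(s+1)) → Tor_(n-1)(J^(s+1)) → 0`, whose outer terms are free by hypothesis and by induction
on `s`. In degree `0` the last term is absent. -/
lemma TorLinear.free_sup (h : TorLinear J) (hr : IsSMulRegular (R ⧸ J) r) {I : Ideal R}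
    (hJ : J ⊔ Ideal.span {r} ≤ I) (n s : ℕ) :
    Module.Free (R ⧸ I) (tor I n ↥((J ⊔ Ideal.span {r}) ^ s)) := by
  let P : Resolution I := projectiveResolution _
  induction s generalizing n with
  | zero =>
    have := h.free I (le_sup_left.trans hJ) n 0
    rwa [pow_zero] at this ⊢
  | succ s ih =>
    have h1 := h.free I (le_sup_left.trans hJ)
    have h2 (n : ℕ) : Module.Free (R ⧸ I)
        (tor I n (↥(J ^ (s + 1)) × ↥((J ⊔ Ideal.span {r}) ^ s))) := by
      have := h1 n (s + 1)
      have := ih n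
      exact free_of_linearEquiv I (torProd I n _ _).symm inferInstance
    cases n with
    | zero =>
      exact free_of_linearEquiv I (LinearEquiv.ofBijective _
        ⟨h.torMap_genMap_injective hr hJ 0 s, torMap_zero_surjective (genMap_surjective s)⟩) (h2 0)
    | succ n =>
      exact free_of_shortExact_quotient I (h.torMap_genMap_injective hr hJ (n + 1) s)
        (torMap_torδ_exact P (relMap_injective s) (relMap_genMap_exact h hr s)
          (genMap_surjective s) n) (h.torδ_surjective hr P hJ n s) (h2 (n + 1)) (h1 n (s + 1))

/-- The `K^(s+1)` summand enters through multiplication by `r ∈ K`; the `J^(s+2)` summand is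
generated by products with elements of `J ⊆ K`, and these products are compatible with the
inclusions of powers of `J` into powers of `K`. -/
lemma TorLinear.torMap_genMap_mem (h : TorLinear J) {I : Ideal R}
    (hJ : J ⊔ Ideal.span {r} ≤ I) (n s : ℕ)
    (w : tor I n (↥(J ^ (s + 1 + 1)) × ↥((J ⊔ Ideal.span {r}) ^ (s + 1)))) :
    torMap I n (genMap J r (s + 1)) w ∈ ⨆ a : ↥(J ⊔ Ideal.span {r}),
      LinearMap.range (torMap I n (mulPow (J ⊔ Ideal.span {r}) a (s + 1))) := by
  obtain ⟨⟨x, y⟩, rfl⟩ := (torProd I n _ _).symm.surjective w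
  change torMap I n (genMap J r (s + 1)) (torMap I n (LinearMap.inl R _ _) x +
    torMap I n (LinearMap.inr R _ _) y) ∈ _
  rw [map_add, torMap_torMap, torMap_torMap, LinearMap.coprod_inl, LinearMap.coprod_inr]
  refine add_mem ?_ (Submodule.mem_iSup_of_mem (supGen J r) ⟨y, rfl⟩)
  suffices hle : ⊤ ≤ Submodule.comap (torMap I n (Submodule.inclusion
      (Ideal.pow_right_mono (le_sup_left : J ≤ J ⊔ Ideal.span {r}) (s + 1 + 1))))
      (⨆ a : ↥(J ⊔ Ideal.span {r}),
        LinearMap.range (torMap I n (mulPow (J ⊔ Ideal.span {r}) a (s + 1)))) from hle trivial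
  rw [← h.gen I (le_sup_left.trans hJ) n s]
  refine iSup_le fun a => ?_
  rintro _ ⟨v, rfl⟩
  rw [Submodule.mem_comap, torMap_torMap]
  refine Submodule.mem_iSup_of_mem ⟨a, Ideal.mem_sup_left a.2⟩
    ⟨torMap I n (Submodule.inclusion (Ideal.pow_right_mono le_sup_left (s + 1))) v, ?_⟩
  rw [torMap_torMap]
  rfl

/-- In positive degree the image of `genMap` is not enough: its cokernel on `Tor` is `Tor_n(R/I,
J^(s+2))`. That module is generated by products with elements of `J`, and the connecting maps
commute with these multiplications, so the generators lift to products in `Tor_(n+1)(R/I, K^(s+2))`,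
where `K = J + (r)`. -/
lemma TorLinear.gen_sup (h : TorLinear J) (hr : IsSMulRegular (R ⧸ J) r) {I : Ideal R}
    (hJ : J ⊔ Ideal.span {r} ≤ I) (n s : ℕ) :
    ⨆ a : ↥(J ⊔ Ideal.span {r}),
      LinearMap.range (torMap I n (mulPow (J ⊔ Ideal.span {r}) a (s + 1))) = ⊤ := by
  let P : Resolution I := projectiveResolution _
  refine eq_top_iff.2 fun x _ => ?_
  cases n with
  | zero =>
    obtain ⟨w, rfl⟩ :=
      torMap_zero_surjective (I := I) (genMap_surjective (J := J) (r := r) (s + 1)) x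
    exact h.torMap_genMap_mem hJ 0 s w
  | succ n =>
    let δ (s : ℕ) := torδ P (relMap_injective s) (relMap_genMap_exact h hr s)
      (genMap_surjective s) n
    have h1 : (⊤ : Submodule R _) ≤ Submodule.map (δ (s + 1)) (⨆ a : ↥(J ⊔ Ideal.span {r}),
        LinearMap.range (torMap I (n + 1) (mulPow (J ⊔ Ideal.span {r}) a (s + 1)))) := by
      rw [← h.gen I (le_sup_left.trans hJ) n s]
      refine iSup_le fun a => ?_
      rintro _ ⟨z, rfl⟩
      obtain ⟨y, rfl⟩ := h.torδ_surjective hr P hJ n s z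
      let a' : ↥(J ⊔ Ideal.span {r}) := ⟨a, Ideal.mem_sup_left a.2⟩
      refine ⟨torMap I (n + 1) (mulPow (J ⊔ Ideal.span {r}) a' (s + 1)) y,
        Submodule.mem_iSup_of_mem a' ⟨y, rfl⟩, ?_⟩
      -- Multiplication by `a` is a morphism from the short exact sequence for `s` to the one for `s
      -- + 1`, acting on both factors of the middle term.
      refine (torδ_naturality P _ _ _ _ _ _ (mulPow J a (s + 1))
        ((mulPow J a (s + 1)).prodMap (mulPow (J ⊔ Ideal.span {r}) a' s)) _ ?_ ?_ n y).symm
      · refine LinearMap.ext fun v => Prod.ext (Subtype.ext ?_) rfl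
        change (a : R) * (-r * (v : R)) = -r * ((a : R) * v)
        ring
      · refine LinearMap.ext fun v => Subtype.ext ?_
        change (a : R) * ((v.1 : R) + r * (v.2 : R)) = (a : R) * v.1 + r * ((a : R) * v.2)
        ring
    -- Here `y` is a sum of products with the same boundary as `x`, so `x - y` comes from `genMap`.
    obtain ⟨y, hy, hyx⟩ := h1 (trivial : δ (s + 1) x ∈ ⊤)
    obtain ⟨w, hw⟩ := (torMap_torδ_exact P (relMap_injective (s + 1))
      (relMap_genMap_exact h hr (s + 1)) (genMap_surjective (s + 1)) n (x - y)).1 (by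
        rw [map_sub]
        exact sub_eq_zero.2 hyx.symm)
    rw [← sub_add_cancel x y, ← hw]
    exact add_mem (h.torMap_genMap_mem hJ (n + 1) s w) hy

lemma TorLinear.sup_span_singleton (h : TorLinear J) (hr : IsSMulRegular (R ⧸ J) r) :
    TorLinear (J ⊔ Ideal.span {r}) :=
  ⟨fun _ hI n s => h.free_sup hr hI n s, fun _ hI n s => h.gen_sup hr hI n s⟩

end Step

/-- Induction over the initial segments of the sequence, each new term being regular modulo the
ideal of its predecessors. -/
lemma torLinear_ofList {rs : List R} (hrs : RingTheory.Sequence.IsWeaklyRegular R rs) :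
    TorLinear (Ideal.ofList rs) := by
  suffices h : ∀ k ≤ rs.length, TorLinear (Ideal.ofList (rs.take k)) by
    simpa using h rs.length le_rfl
  intro k hk
  induction k with
  | zero => simpa using torLinear_bot
  | succ k ih =>
    have h1 := hrs.regular_mod_prev k hk
    rw [smul_eq_mul, Ideal.mul_top] at h1
    rw [List.take_add_one, List.getElem?_eq_getElem hk, Ideal.ofList_append]
    simpa using (ih (by omega)).sup_span_singleton h1

/-! ### The reduced `Tor` of a power -/

section Reduced

variable {I : Ideal R}

lemma inclusion_mkQ_exact (I : Ideal R) {a b : ℕ} (hab : a ≤ b) :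
    Function.Exact (Submodule.inclusion (Ideal.pow_le_pow_right hab) : ↥(I ^ b) →ₗ[R] ↥(I ^ a))
      (Submodule.comap (I ^ a).subtype (I ^ b)).mkQ := by
  intro x
  rw [Submodule.mkQ_apply, Submodule.Quotient.mk_eq_zero]
  exact ⟨fun hx => ⟨⟨x, hx⟩, rfl⟩, by rintro ⟨y, rfl⟩; exact y.2⟩

/-- The connecting homomorphism of `0 → I^s → R → R/I^s → 0`. -/
def ringδ (P : Resolution I) (s n : ℕ) : tor I (n + 1) (R ⧸ I ^ s) →ₗ[R] tor I n ↥(I ^ s) :=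
  torδ P (I ^ s).injective_subtype (LinearMap.exact_subtype_mkQ (I ^ s)) (I ^ s).mkQ_surjective n

/-- The connecting homomorphism of `0 → I^b → I^a → I^a/I^b → 0`. -/
def powδ (P : Resolution I) {a b : ℕ} (hab : a ≤ b) (n : ℕ) :
    tor I (n + 1) (PowQuot I a b) →ₗ[R] tor I n ↥(I ^ b) :=
  torδ P (Submodule.inclusion_injective (Ideal.pow_le_pow_right hab))
    (inclusion_mkQ_exact I hab) (Submodule.mkQ_surjective _) n

/-- The next map in the long exact sequence, induced by `I^s → R`, is zero on `Tor`. -/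
lemma ringδ_surjective (P : Resolution I) {s : ℕ} (hs : s ≠ 0) (n : ℕ) :
    Function.Surjective (ringδ P s n) := fun x =>
  (torδ_torMap_exact P (I ^ s).injective_subtype (LinearMap.exact_subtype_mkQ (I ^ s))
    (I ^ s).mkQ_surjective n x).1 (by
      rw [torMap_subtype_eq_zero (Ideal.pow_le_self hs), LinearMap.zero_apply])

lemma torUnit_ringδ_exact (P : Resolution I) (s n : ℕ) :
    Function.Exact (torUnit I (I ^ s) (n + 1)) (ringδ P s n) :=
  torMap_torδ_exact P (I ^ s).injective_subtype (LinearMap.exact_subtype_mkQ (I ^ s))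
    (I ^ s).mkQ_surjective n

/-- Since reduced `Tor` vanishes in degree `0`, only positive degrees call for connecting maps
below. -/
lemma reducedTor_zero_subsingleton (I J : Ideal R) : Subsingleton (reducedTor I J 0) := by
  rw [Submodule.Quotient.subsingleton_iff, LinearMap.range_eq_top]
  exact torMap_zero_surjective J.mkQ_surjective

lemma TorLinear.powδ_surjective (h : TorLinear I) (P : Resolution I) {a b : ℕ} (hb : a + 1 = b)
    (n : ℕ) : Function.Surjective (powδ P (a.le_succ.trans_eq hb) n) := by
  subst hb
  exact fun x => (torδ_torMap_exact P
    (Submodule.inclusion_injective (Ideal.pow_le_pow_right a.le_succ))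
    (inclusion_mkQ_exact I a.le_succ) (Submodule.mkQ_surjective _) n x).1
      ((LinearMap.congr_fun (h.torMap_powIncl le_rfl n a) x).trans (LinearMap.zero_apply x))

/-- The connecting map `ringδ` is onto with kernel the image of `torUnit`, so it identifies reduced
`Tor_(n+1)(R/I, R/I^s)` with `Tor_n(R/I, I^s)`. -/
lemma TorLinear.reducedTor_free (h : TorLinear I) {s : ℕ} (hs : s ≠ 0) (n : ℕ) :
    Module.Free (R ⧸ I) (reducedTor I (I ^ s) n) := by
  let P : Resolution I := projectiveResolution _
  cases n with
  | zero =>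
    have := reducedTor_zero_subsingleton I (I ^ s)
    infer_instance
  | succ n =>
    have e : reducedTor I (I ^ s) (n + 1) ≃ₗ[R] tor I n ↥(I ^ s) :=
      Submodule.quotEquivOfEq _ _ (torUnit_ringδ_exact P s n).linearMap_ker_eq.symm ≪≫ₗ
        (ringδ P s n).quotKerEquivOfSurjective (ringδ_surjective P hs n)
    exact free_of_linearEquiv I e.symm (h.free I le_rfl n s)

/-- The connecting homomorphism of `0 → I^b/I^c → I^a/I^c → I^a/I^b → 0` factors over
`Tor(R/I, I^b)`. -/
lemma connecting_eq (P : Resolution I) {a b c : ℕ} (hab : a ≤ b) (hbc : b ≤ c) (n : ℕ)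
    (x : tor I (n + 1) (PowQuot I a b)) :
    connecting P hab hbc n x =
      torMap I n (Submodule.comap (I ^ b).subtype (I ^ c)).mkQ (powδ P hab n x) := by
  have h := torδ_naturality P (Submodule.inclusion_injective (Ideal.pow_le_pow_right hab))
    (inclusion_mkQ_exact I hab) (Submodule.mkQ_surjective _) (powQuot_exact I hab hbc).1
    (powQuot_exact I hab hbc).2.1 (powQuot_exact I hab hbc).2.2
    (Submodule.comap (I ^ b).subtype (I ^ c)).mkQ
    (Submodule.comap (I ^ a).subtype (I ^ c)).mkQ LinearMap.id rfl rfl n x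
  rw [torMap_id, LinearMap.id_apply] at h
  rw [connecting_eq_torδ, powδ, h]

/-- Naturality for the inclusion of `0 → I^c → I^b → I^b/I^c → 0` into `0 → I^c → R → R/I^c → 0`,
which is the identity on `I^c`. -/
lemma ringδ_powQuotIncl (P : Resolution I) {b c : ℕ} (hbc : b ≤ c) (n : ℕ)
    (x : tor I (n + 1) (PowQuot I b c)) :
    ringδ P c n (torMap I (n + 1) (powQuotIncl I b c) x) = powδ P hbc n x := by
  have h := torδ_naturality P (Submodule.inclusion_injective (Ideal.pow_le_pow_right hbc))
    (inclusion_mkQ_exact I hbc) (Submodule.mkQ_surjective _)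
    (I ^ c).injective_subtype (LinearMap.exact_subtype_mkQ (I ^ c))
    (I ^ c).mkQ_surjective LinearMap.id (I ^ b).subtype (powQuotIncl I b c) rfl rfl n x
  rw [torMap_id, LinearMap.id_apply] at h
  rw [ringδ, powδ, h]

/-- A reduced class in positive degree is determined by its image under `ringδ`, and `powδ` from
`I^b/I^c` already reaches every element of `Tor(R/I, I^c)`. -/
lemma TorLinear.reducedProj_surjective (h : TorLinear I) {b c : ℕ} (hc : b + 1 = c) (n : ℕ) :
    Function.Surjective (reducedProj I (I ^ c) n ∘ₗ torMap I n (powQuotIncl I b c)) := by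
  let P : Resolution I := projectiveResolution _
  cases n with
  | zero =>
    have := reducedTor_zero_subsingleton I (I ^ c)
    exact fun y => ⟨0, Subsingleton.elim _ _⟩
  | succ n =>
    intro y
    obtain ⟨y, rfl⟩ := Submodule.mkQ_surjective _ y
    obtain ⟨x, hx⟩ := h.powδ_surjective P hc n (ringδ P c n y)
    refine ⟨x, (Submodule.Quotient.eq _).2 ((torUnit_ringδ_exact P c n _).1 ?_)⟩
    rw [map_sub, ringδ_powQuotIncl P (b.le_succ.trans_eq hc), hx, sub_self]

/-- Kernel and image both equal the image of `Tor_n(R/I, I^b)`. The image of `connecting` does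
because it factors through the surjection `powδ`. In positive degree the kernel is that of `powδ`
into `Tor_(n-1)(R/I, I^c)`, because `ringδ` is injective on reduced `Tor`; the long exact sequence
of `I^c → I^b → I^b/I^c` then applies. -/
lemma TorLinear.connecting_exact (h : TorLinear I) (P : Resolution I) {a b c : ℕ}
    (hb : a + 1 = b) (hbc : b ≤ c) (n : ℕ) :
    Function.Exact (connecting P (a.le_succ.trans_eq hb) hbc n)
      (reducedProj I (I ^ c) n ∘ₗ torMap I n (powQuotIncl I b c)) := by
  have hrange (x : tor I n (PowQuot I b c)) :
      x ∈ Set.range (connecting P (a.le_succ.trans_eq hb) hbc n) ↔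
      x ∈ Set.range (torMap I n (Submodule.comap (I ^ b).subtype (I ^ c)).mkQ) := by
    constructor
    · rintro ⟨y, rfl⟩
      exact ⟨_, (connecting_eq P (a.le_succ.trans_eq hb) hbc n y).symm⟩
    · rintro ⟨z, rfl⟩
      obtain ⟨y, rfl⟩ := h.powδ_surjective P hb n z
      exact ⟨y, connecting_eq P (a.le_succ.trans_eq hb) hbc n y⟩
  intro x
  rw [hrange]
  cases n with
  | zero =>
    have := reducedTor_zero_subsingleton I (I ^ c)
    -- In degree `0` the target is zero, and `Tor_0(R/I, I^b)` maps onto everything by right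
    -- exactness.
    exact ⟨fun _ => torMap_zero_surjective (Submodule.mkQ_surjective _) x,
      fun _ => Subsingleton.elim _ _⟩
  | succ n =>
    rw [LinearMap.comp_apply, Submodule.mkQ_apply, Submodule.Quotient.mk_eq_zero]
    refine (torUnit_ringδ_exact P c n _).symm.trans ?_
    rw [ringδ_powQuotIncl P hbc]
    exact torMap_torδ_exact P (Submodule.inclusion_injective (Ideal.pow_le_pow_right hbc))
      (inclusion_mkQ_exact I hbc) (Submodule.mkQ_surjective _) n x

end Reduced

/-! ### The product -/

section Product

variable {I : Ideal R} {P : Resolution I}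

/-- For `b ≠ 0` the coefficients lie in `I`, so the augmentation vanishes already on chains. -/
lemma augmentation_powQuotIncl {b s : ℕ} (hb : b ≠ 0) (hs : I ^ s ≤ I) (n : ℕ)
    (x : tor I n (PowQuot I b s)) : augmentation P hs n (torMap I n (powQuotIncl I b s) x) = 0 := by
  have h1 : tensorComplexMap P (powQuotIncl I b s) ≫ augComplexMap P hs = 0 := by
    apply HomologicalComplex.to_single_hom_ext
    refine ModuleCat.hom_ext ?_
    refine TensorProduct.ext' fun p y => ?_
    obtain ⟨y, rfl⟩ := Submodule.Quotient.mk_surjective _ y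
    have h : Submodule.factor hs (powQuotIncl I b s (Submodule.Quotient.mk y)) = 0 :=
      (Submodule.Quotient.mk_eq_zero I).2 (Ideal.pow_le_self hb y.2)
    exact (congrArg (fun z => P.aug p * z) h).trans (mul_zero _)
  have h2 : ModuleCat.ofHom (torMap I n (powQuotIncl I b s)) ≫ (torIso P n (R ⧸ I ^ s)).hom ≫
      HomologicalComplex.homologyMap (augComplexMap P hs) n = 0 := by
    rw [torMap_eq P, Category.assoc, Category.assoc, Iso.inv_hom_id_assoc,
      ← HomologicalComplex.homologyMap_comp, h1, HomologicalComplex.homologyMap_zero,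
      Limits.comp_zero]
  exact congrArg (fun f => f.hom x) h2

/-- The classes from `I^b/I^s` lie in the kernel of the augmentation, so they are their own
representatives under the splitting. -/
lemma reducedEquiv_powQuotIncl {b s : ℕ} (hb : b ≠ 0) (hs : I ^ s ≤ I) (n : ℕ)
    (x : tor I n (PowQuot I b s)) :
    (reducedEquiv P hs n ((reducedProj I (I ^ s) n ∘ₗ torMap I n (powQuotIncl I b s)) x) :
      tor I n (R ⧸ I ^ s)) = torMap I n (powQuotIncl I b s) x :=
  congrArg Subtype.val (Submodule.quotientEquivOfIsCompl_apply_mk_right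
    (isCompl_ker_augmentation P hs n) ⟨_, augmentation_powQuotIncl hb hs n x⟩)

/-- Supplies representatives: a class in the image of `φ` on homology is represented by a cycle in
the image of `φ` on chains. -/
lemma homologyEquiv_homologyMap {C D : ChainComplex (ModuleCat.{u} R) ℕ} (φ : C ⟶ D) (n : ℕ)
    (x : C.homology n) : ∃ (z : cyc C n) (w : cyc D n), w.1 = (φ.f n).hom z.1 ∧
      homologyEquiv D n ((HomologicalComplex.homologyMap φ n).hom x) = Submodule.Quotient.mk w := by
  obtain ⟨c, rfl⟩ := (ModuleCat.epi_iff_surjective (C.homologyπ n)).1 inferInstance x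
  refine ⟨(C.sc n).moduleCatCyclesIso.hom.hom c,
    (D.sc n).moduleCatCyclesIso.hom.hom ((HomologicalComplex.cyclesMap φ n).hom c), ?_, ?_⟩
  · have h1 := congrArg (fun f => f.hom ((HomologicalComplex.cyclesMap φ n).hom c))
      (D.sc n).moduleCatCyclesIso_hom_i
    have h2 := congrArg (fun f => f.hom c) (HomologicalComplex.cyclesMap_i φ n)
    have h3 := congrArg (fun f => (φ.f n).hom (f.hom c)) (C.sc n).moduleCatCyclesIso_hom_i
    exact (h1.trans h2).trans h3.symm
  · have h1 := congrArg (fun f => (D.sc n).moduleCatHomologyIso.hom.hom (f.hom c))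
      (HomologicalComplex.homologyπ_naturality φ n)
    have h2 := congrArg (fun f => f.hom ((HomologicalComplex.cyclesMap φ n).hom c))
      (D.sc n).π_moduleCatCyclesIso_hom
    exact h1.trans h2

/-- On pure tensors the coefficients multiply into `I^(2b) ⊆ I^s`, whatever the chain-level product
`μ` is. -/
lemma mulChain_powQuotIncl (μ : ProductLift P) {b s : ℕ} (hbs : s ≤ b + b) (i j : ℕ)
    (x : (tensorComplex P (PowQuot I b s)).X i) (y : (tensorComplex P (PowQuot I b s)).X j) :
    μ.mulChain (R ⧸ I ^ s) i j (i + j) rfl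
      (((tensorComplexMap P (powQuotIncl I b s)).f i).hom x)
      (((tensorComplexMap P (powQuotIncl I b s)).f j).hom y) = 0 := by
  have h : (μ.mulChain (R ⧸ I ^ s) i j (i + j) rfl).compl₁₂
      ((tensorComplexMap P (powQuotIncl I b s)).f i).hom
      ((tensorComplexMap P (powQuotIncl I b s)).f j).hom = 0 := by
    refine TensorProduct.ext' fun p v => ?_
    refine TensorProduct.ext' fun q w => ?_
    obtain ⟨v, rfl⟩ := Submodule.Quotient.mk_surjective _ v
    obtain ⟨w, rfl⟩ := Submodule.Quotient.mk_surjective _ w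
    have h : powQuotIncl I b s (Submodule.Quotient.mk v) *
        powQuotIncl I b s (Submodule.Quotient.mk w) = 0 :=
      (Submodule.Quotient.mk_eq_zero (I ^ s)).2 (Ideal.pow_le_pow_right hbs (by
        rw [pow_add]
        exact Ideal.mul_mem_mul v.2 w.2))
    exact (congrArg (fun z => μ.pairing i j (i + j) rfl p q ⊗ₜ[R] z) h).trans
      (TensorProduct.tmul_zero _ _)
  exact congrArg (fun B => B x y) h

lemma torMul_powQuotIncl (μ : ProductLift P) {b s : ℕ} (hbs : s ≤ b + b) (i j : ℕ)
    (x : tor I i (PowQuot I b s)) (y : tor I j (PowQuot I b s)) :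
    torMul μ (R ⧸ I ^ s) i j (torMap I i (powQuotIncl I b s) x)
      (torMap I j (powQuotIncl I b s) y) = 0 := by
  have key (n : ℕ) (x : tor I n (PowQuot I b s)) :
      ∃ (z : cyc (tensorComplex P (PowQuot I b s)) n) (w : cyc (tensorComplex P (R ⧸ I ^ s)) n),
        w.1 = ((tensorComplexMap P (powQuotIncl I b s)).f n).hom z.1 ∧
        ((torIso P n (R ⧸ I ^ s)).toLinearEquiv ≪≫ₗ
          homologyEquiv (tensorComplex P (R ⧸ I ^ s)) n) (torMap I n (powQuotIncl I b s) x) =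
          Submodule.Quotient.mk w := by
    obtain ⟨z, w, h1, h2⟩ := homologyEquiv_homologyMap (tensorComplexMap P (powQuotIncl I b s)) n
      ((torIso P n (PowQuot I b s)).hom.hom x)
    refine ⟨z, w, h1, h2 ▸ ?_⟩
    rw [torMap_apply P, LinearEquiv.trans_apply]
    exact congrArg (homologyEquiv _ n) 
      ((torIso P n (R ⧸ I ^ s)).toLinearEquiv.apply_symm_apply _)
  obtain ⟨z, w, h1, h2⟩ := key i x
  obtain ⟨z', w', h1', h2'⟩ := key j y
  have h3 : mulCycles μ (R ⧸ I ^ s) i j w w' = 0 := by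
    refine Subtype.ext ?_
    change μ.mulChain (R ⧸ I ^ s) i j (i + j) rfl w.1 w'.1 = 0
    rw [h1, h1', mulChain_powQuotIncl μ hbs]
  have h4 : mulQuotient μ (R ⧸ I ^ s) i j (Submodule.Quotient.mk w)
      (Submodule.Quotient.mk w') = 0 :=
    (congrArg Submodule.Quotient.mk h3).trans (Submodule.Quotient.mk_zero _)
  rw [← h2, ← h2'] at h4
  exact (congrArg ((torIso P (i + j) (R ⧸ I ^ s)).toLinearEquiv ≪≫ₗ
    homologyEquiv (tensorComplex P (R ⧸ I ^ s)) (i + j)).symm h4).trans (map_zero _)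

end Product

end RegularQuotient

end

open RegularQuotient in
theorem mainTheorem2 {R : Type u} [CommRing R] (rs : List R)
    (hrs : RingTheory.Sequence.IsRegular R rs) (I : Ideal R) (hI : I = Ideal.ofList rs)
    (s : ℕ) (hs : 1 < s) (P : Resolution I) (μ : ProductLift P) :
    (∀ n : ℕ,
      Function.Exact
        (connecting P (a := s - 2) (b := s - 1) (c := s) (by omega) (by omega) n)
        (reducedProj I (I ^ s) n ∘ₗ torMap I n (powQuotIncl I (s - 1) s)) ∧
      Function.Surjective
        (reducedProj I (I ^ s) n ∘ₗ torMap I n (powQuotIncl I (s - 1) s)) ∧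
      Module.Free (R ⧸ I) (reducedTor I (I ^ s) n)) ∧
    (∀ (i j : ℕ) (x : reducedTor I (I ^ s) i) (y : reducedTor I (I ^ s) j),
      torMul μ (R ⧸ I ^ s) i j
        (reducedEquiv P (Ideal.pow_le_self (by omega : s ≠ 0)) i x)
        (reducedEquiv P (Ideal.pow_le_self (by omega : s ≠ 0)) j y) = 0) := by
  have h : TorLinear I := hI ▸ torLinear_ofList hrs.toIsWeaklyRegular
  refine ⟨fun n => ⟨h.connecting_exact P (by omega) (by omega) n,
    h.reducedProj_surjective (by omega) n, h.reducedTor_free (by omega) n⟩, fun i j x y => ?_⟩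
  obtain ⟨x, rfl⟩ := h.reducedProj_surjective (b := s - 1) (by omega) i x
  obtain ⟨y, rfl⟩ := h.reducedProj_surjective (b := s - 1) (by omega) j y
  -- The side condition here is `s - 1 ≠ 0`, and on the next line `s ≤ 2(s - 1)`; each amounts to `1
  -- < s`.
  rw [reducedEquiv_powQuotIncl (by omega), reducedEquiv_powQuotIncl (by omega)]
  exact torMul_powQuotIncl μ (by omega) i j x y
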